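/- Let $K\ge 1$ and let $\mu_1,\dots,\mu_K\in\mathbb R$ with $\mu_1=\max_k\mu_k$; put $\Delta_k=\mu_1-\mu_k$. In the $K$-armed Gaussian bandit the successive pulls of arm $k$ yield rewards $Y_{k,1},Y_{k,2},\dots$ with law $N(\mu_k,1)$, all rewards being independent. Fix $\sigma_a>1.5$. The algorithm ReBoot with exploration aid unit $\sigma_a$ and Gaussian weights pulls arm $t$ in round $t$ for $t=1,\dots,K$. In each round $t>K$, for every arm $k$, if $s$ is the number of pulls of arm $k$ so far and $\bar Y_{k,s}=s^{-1}\sum_{i=1}^{s}Y_{k,i}$, it sets $e_{k,i}=Y_{k,i}-\bar Y_{k,s}$ for $i\le s$, $e_{k,s+1}=\sqrt{s+2}\,\sigma_a$, $e_{k,s+2}=-\sqrt{s+2}\,\sigma_a$, draws fresh independent weights $w_1,\dots,w_{s+2}\sim N(0,1)$ (independent across rounds and arms, and of the rewards), and computes the index $$\hat\mu_k^*=\bar Y_{k,s}+\frac1{s+2}\sum_{i=1}^{s+2}w_i e_{k,i};$$ it then pulls an arm $I_t$ maximizing $\hat\mu_k^*$ over $k$ (ties, which have probability zero, are broken by any fixed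 measurable rule). Let $r_t$ be the reward received in round $t$. Then for every number of rounds $T\ge 1$ the total reward $\sum_{t=1}^T r_t$ is integrable, and the regret $R(T)=T\mu_1-E\big[\sum_{t=1}^{T}r_t\big]$ satisfies $$R(T)\le\sum_{k=2}^{K}\Delta_k\Big[6+\big\{C_1(\sigma_a)+C_2(\sigma_a)\Delta_k^{-2}\big\}\log T\Big],$$ where $$C_1(\sigma_a)=\frac{8}{2\sigma_a^2-1},\qquad C_2(\sigma_a)=128\,\sigma_a^2\Big(3.1+2\big(1-2.25\,\sigma_a^{-2}\big)^{-1/2}\Big),$$ and terms with $\Delta_k=0$ are read as $0$. -/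

import Mathlib

open MeasureTheory ProbabilityTheory

namespace ReBoot

/-- Sample mean of the first `s` rewards `y 0, …, y (s - 1)` of one arm. -/
noncomputable def sampleMean (y : ℕ → ℝ) (s : ℕ) : ℝ :=
  (∑ i ∈ Finset.range s, y i) / s

/-- The augmented residuals: positions `0, …, s - 1` carry the residuals of the `s` rewards,
positions `s` and `s + 1` carry the two pseudo residuals `± √(s + 2) σ_a`. -/
noncomputable def residual (σa : ℝ) (y : ℕ → ℝ) (s i : ℕ) : ℝ :=
  if i < s then y i - sampleMean y s
  else if i = s then √((s : ℝ) + 2) * σa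
  else -(√((s : ℝ) + 2) * σa)

/-- The index of an arm with rewards `y 0, …, y (s - 1)` under bootstrap weights
`w 0, …, w (s + 1)`: sample mean plus the average of the `s + 2` perturbed residuals. -/
noncomputable def armIndex (σa : ℝ) (y : ℕ → ℝ) (s : ℕ) (w : ℕ → ℝ) : ℝ :=
  sampleMean y s + (∑ i ∈ Finset.range (s + 2), w i * residual σa y s i) / ((s : ℝ) + 2)

/-- `sel` returns a coordinate at which a vector is maximal (a rule for breaking ties). -/
def IsArgmax {K : ℕ} (sel : (Fin K → ℝ) → Fin K) : Prop :=
  ∀ (v : Fin K → ℝ) (j : Fin K), v j ≤ v (sel v)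

/-- The arm pulled in round `t` (rounds are `0, 1, 2, …`), when arm `k` has been pulled `n k` times
and the weights of the round are `w k i`: arm `t` in the first `K` rounds, afterwards the arm with
the largest index. `y k l` is the reward of the pull number `l` (from `0`) of arm `k`. -/
noncomputable def chooseArm {K : ℕ} (sel : (Fin K → ℝ) → Fin K) (σa : ℝ)
    (y : Fin K → ℕ → ℝ) (w : Fin K → ℕ → ℝ) (t : ℕ) (n : Fin K → ℕ) : Fin K :=
  if h : t < K then ⟨t, h⟩ else sel (fun k => armIndex σa (y k) (n k) (w k))

/-- Number of pulls of each arm in the first `t` rounds; `w t k i` is the weight number `i`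
generated for arm `k` in round `t`. -/
noncomputable def pulls {K : ℕ} (sel : (Fin K → ℝ) → Fin K) (σa : ℝ)
    (y : Fin K → ℕ → ℝ) (w : ℕ → Fin K → ℕ → ℝ) : ℕ → Fin K → ℕ
  | 0 => fun _ => 0
  | t + 1 => fun k =>
      pulls sel σa y w t k +
        if chooseArm sel σa y (w t) t (pulls sel σa y w t) = k then 1 else 0

/-- The arm pulled in round `t`. -/
noncomputable def arm {K : ℕ} (sel : (Fin K → ℝ) → Fin K) (σa : ℝ)
    (y : Fin K → ℕ → ℝ) (w : ℕ → Fin K → ℕ → ℝ) (t : ℕ) : Fin K :=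
  chooseArm sel σa y (w t) t (pulls sel σa y w t)

/-- The reward received in round `t`. -/
noncomputable def reward {K : ℕ} (sel : (Fin K → ℝ) → Fin K) (σa : ℝ)
    (y : Fin K → ℕ → ℝ) (w : ℕ → Fin K → ℕ → ℝ) (t : ℕ) : ℝ :=
  y (arm sel σa y w t) (pulls sel σa y w t (arm sel σa y w t))

/-- Sum of the rewards received in the first `T` rounds. -/
noncomputable def totalReward {K : ℕ} (sel : (Fin K → ℝ) → Fin K) (σa : ℝ)
    (y : Fin K → ℕ → ℝ) (w : ℕ → Fin K → ℕ → ℝ) (T : ℕ) : ℝ :=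
  ∑ t ∈ Finset.range T, reward sel σa y w t

/-- The `T`-round regret `T μ₁ - E[∑ r_t]` (the optimal arm is arm `0`). -/
noncomputable def regret {K : ℕ} [NeZero K] {Ω : Type*} [MeasurableSpace Ω] (P : Measure Ω)
    (μ : Fin K → ℝ) (sel : (Fin K → ℝ) → Fin K) (σa : ℝ)
    (Y : Fin K → ℕ → Ω → ℝ) (W : ℕ → Fin K → ℕ → Ω → ℝ) (T : ℕ) : ℝ :=
  T * μ 0 - ∫ ω, totalReward sel σa (fun k l => Y k l ω) (fun t k i => W t k i ω) T ∂P

/-- Sub-optimality gap of arm `k`. -/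
def gap {K : ℕ} [NeZero K] (μ : Fin K → ℝ) (k : Fin K) : ℝ := μ 0 - μ k

noncomputable def C₁ (σa : ℝ) : ℝ := 8 * (2 * σa ^ 2 - 1)⁻¹

noncomputable def C₂ (σa : ℝ) : ℝ :=
  128 * σa ^ 2 * (3.1 + 2 * (1 - 2.25 * (σa ^ 2)⁻¹) ^ (-(1 / 2) : ℝ))

/-- The random variables driving ReBoot with Gaussian weights on the Gaussian bandit with means
`μ` and unit variances: the successive rewards `Y k 0, Y k 1, …` of arm `k` have law `N(μ k, 1)`,
the bootstrap weights have law `N(0, 1)`, and all of them are jointly independent. -/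
structure IsGaussianModel {K : ℕ} {Ω : Type*} [MeasurableSpace Ω] (P : Measure Ω)
    (μ : Fin K → ℝ) (Y : Fin K → ℕ → Ω → ℝ) (W : ℕ → Fin K → ℕ → Ω → ℝ) : Prop where
  measurable_reward : ∀ k l, Measurable (Y k l)
  measurable_weight : ∀ t k i, Measurable (W t k i)
  law_reward : ∀ k l, P.map (Y k l) = gaussianReal (μ k) 1
  law_weight : ∀ t k i, P.map (W t k i) = gaussianReal 0 1
  indep : iIndepFun
    (Sum.elim (fun p : Fin K × ℕ => Y p.1 p.2) (fun q : ℕ × Fin K × ℕ => W q.1 q.2.1 q.2.2)) P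

end ReBoot

/-! Since the regret equals the sum over `k` of `gap μ k` times the expected number of pulls of arm
`k`, it suffices to bound that number for each arm with `Δ = gap μ k > 0`. Let `τ = μ k + Δ / 2 = μ
0 - Δ / 2` be the midpoint. Given the rewards, the index of an arm after `s` pulls is Gaussian, with
the sample mean as its mean and `indexVar` as its variance; let `Q` (`exceedProb`) be the
conditional probability that it exceeds `τ`.

The pulls of arm `k` after the initial rounds are of three kinds. (a) The index exceeds `τ` although
`Q ≤ 1 / T` for arm `k`: at most one such pull in expectation. (b) `Q > 1 / T` for arm `k`: distinct
pulls have distinct `s`, so these cost at most the sum over `s` of the probability of that event.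
(c) The index of arm `k` is at most `τ`, hence every index is. Weights of different arms being
independent, this has conditional probability at most `1 / Q - 1`, now with `Q` for arm `0`, times
the probability of pulling arm `0` (`measure_chooseArm_le`). Summing over the pulls of arm `0`
leaves the sum over `s` of `E[1 / Q - 1]`. `sum_measure_arm_le` collects the three.

The rest is Gaussian estimation for a fixed `s`. The pseudo residuals keep the variance above `2 σa²
/ (s + 2)`, so `1 / Q` grows at most like `exp (b Z²)`, with `Z` the standardized sample mean and `b
= 21 / (20 σa²)`. As `σa > 1.5`, `b < 1 / 2` and the expectation is finite uniformly in `s`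
(`lintegral_inv_exceedProb_sub_one_le`). Once `s + 2 ≥ 128 σa² log T / Δ²`, concentration of the
sample mean and of the residual sum of squares makes both contributions `O(1 / T + 2⁻ˢ)`. The values
of `s` below this threshold yield the `C₂` term, the others a constant. The `C₁` term is nonnegative
slack. -/

namespace ReBoot

/-! ### Tails and exponential moments of the normal law. -/

/-- Upper tail function of the standard normal law. -/
noncomputable def gaussTail (x : ℝ) : ℝ := (gaussianReal 0 1).real (Set.Ioi x)

lemma gaussTail_le_one (x : ℝ) : gaussTail x ≤ 1 := measureReal_le_one

lemma gaussTail_antitone : Antitone gaussTail := fun _ _ h =>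
  measureReal_mono (Set.Ioi_subset_Ioi h)

lemma measurable_gaussTail : Measurable gaussTail := gaussTail_antitone.measurable

lemma gaussTail_le_exp {x : ℝ} (hx : 0 ≤ x) : gaussTail x ≤ Real.exp (-(x ^ 2 / 2)) := by
  have h := measure_ge_le_exp_mul_mgf (μ := gaussianReal 0 1) (X := id) x hx
    (integrable_exp_mul_gaussianReal x)
  rw [mgf_id_gaussianReal, ← Real.exp_add] at h
  refine (measureReal_mono ?_).trans (h.trans (le_of_eq ?_))
  · intro y hy
    exact le_of_lt (Set.mem_Ioi.1 hy)
  · congr 1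
    simp
    ring

lemma gaussTail_neg (x : ℝ) : gaussTail (-x) = 1 - gaussTail x := by
  have := nullSingletonClass_gaussianReal (μ := 0) (v := 1) one_ne_zero
  have h1 : gaussTail (-x) = (gaussianReal 0 1).real (Set.Iio x) := by
    have h := gaussianReal_map_neg (μ := 0) (v := 1)
    rw [neg_zero] at h
    unfold gaussTail
    conv_lhs => rw [← h]
    rw [map_measureReal_apply (by fun_prop) measurableSet_Ioi]
    congr 1
    ext y
    simp
  have h2 : (gaussianReal 0 1).real (Set.Iio x) = (gaussianReal 0 1).real (Set.Iic x) :=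
    measureReal_congr Iio_ae_eq_Iic
  have h3 := probReal_add_probReal_compl (μ := gaussianReal 0 1) (s := Set.Iic x) measurableSet_Iic
  rw [Set.compl_Iic] at h3
  rw [h1, h2]
  unfold gaussTail
  linarith

lemma one_sub_gaussTail_le_exp {x : ℝ} (hx : x ≤ 0) :
    1 - gaussTail x ≤ Real.exp (-(x ^ 2 / 2)) := by
  rw [← gaussTail_neg]
  simpa using gaussTail_le_exp (neg_nonneg.2 hx)

lemma half_le_gaussTail {x : ℝ} (hx : x ≤ 0) : 1 / 2 ≤ gaussTail x := by
  have h := gaussTail_neg x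
  have := gaussTail_antitone (show x ≤ -x by linarith)
  linarith

/-- Bound the tail by the mass of `(x, x + 1]` and apply Jensen's inequality to the exponential
there. The rate `7 / 10` exceeds the sharp `1 / 2`, but is below the `3 / 4` at which the exponent
`b` used later would give `2 b = 2.25 / σa²`. -/
lemma le_gaussTail (x : ℝ) :
    1 / 5 * Real.exp (-(7 / 10 * x ^ 2)) ≤ gaussTail x := by
  have hd : ∀ y : ℝ, gaussianPDFReal 0 1 y = (√(2 * Real.pi))⁻¹ * Real.exp (-(y ^ 2 / 2)) := by
    intro y
    simp [gaussianPDFReal, neg_div]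
  have hint : IntegrableOn (fun y => gaussianPDFReal 0 1 y) (Set.Ioi x) :=
    (integrable_gaussianPDFReal 0 1).integrableOn
  have h1 : ∫ y in Set.Ioc x (x + 1), gaussianPDFReal 0 1 y ≤ gaussTail x := by
    unfold gaussTail
    rw [measureReal_def, gaussianReal_apply_eq_integral 0 one_ne_zero,
      ENNReal.toReal_ofReal (integral_nonneg fun y => gaussianPDFReal_nonneg _ _ _)]
    exact setIntegral_mono_set hint
      (Filter.Eventually.of_forall fun y => gaussianPDFReal_nonneg _ _ _)
      (Filter.Eventually.of_forall fun y hy => hy.1)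
  rw [← intervalIntegral.integral_of_le (by linarith)] at h1
  -- `c` is the average of `y² / 2` over `[x, x + 1]`; the tangent line of `exp` at `-c` therefore
  -- integrates to exactly `exp (-c)`.
  set c : ℝ := (x ^ 2 + x + 1 / 3) / 2 with hc
  set A : ℝ := (√(2 * Real.pi))⁻¹ * Real.exp (-c) with hA
  have hA0 : 0 ≤ A := by positivity
  have h2 : ∫ y in x..(x + 1), A * (1 + c - y ^ 2 / 2) ≤
      ∫ y in x..(x + 1), gaussianPDFReal 0 1 y := by
    refine intervalIntegral.integral_mono_on (by linarith) ?_
      (integrable_gaussianPDFReal 0 1).intervalIntegrable ?_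
    · exact Continuous.intervalIntegrable (by fun_prop) _ _
    · intro y _
      rw [hd, hA, mul_assoc]
      refine mul_le_mul_of_nonneg_left ?_ (by positivity)
      have h := Real.add_one_le_exp (c - y ^ 2 / 2)
      have h' : Real.exp (-(y ^ 2 / 2)) = Real.exp (-c) * Real.exp (c - y ^ 2 / 2) := by
        rw [← Real.exp_add]; congr 1; ring
      rw [h']
      refine mul_le_mul_of_nonneg_left ?_ (Real.exp_pos _).le
      linarith
  have h3 : ∫ y in x..(x + 1), A * (1 + c - y ^ 2 / 2) = A := by
    rw [intervalIntegral.integral_const_mul, intervalIntegral.integral_sub (by simp)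
      (Continuous.intervalIntegrable (by fun_prop) _ _), intervalIntegral.integral_div,
      integral_pow, intervalIntegral.integral_const]
    simp only [smul_eq_mul, hc]
    norm_num
    ring_nf
  rw [h3] at h2
  refine le_trans ?_ (h2.trans h1)
  have hs : √(2 * Real.pi) ≤ 2.6 := by
    rw [Real.sqrt_le_left (by norm_num)]
    have := Real.pi_lt_d2
    linarith
  have hs0 : 0 < √(2 * Real.pi) := by positivity
  have hcx : c ≤ 7 / 10 * x ^ 2 + 1 / 2 := by
    rw [hc]
    nlinarith [sq_nonneg (x - 5 / 4)]
  have he : Real.exp (1 / 2) ≤ 1.7 := by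
    have h := Real.exp_one_lt_d9
    have h' : Real.exp (1 / 2) ^ 2 = Real.exp 1 := by
      rw [← Real.exp_nat_mul]; norm_num
    nlinarith [Real.exp_pos (1 / 2)]
  have h4 : Real.exp (-(7 / 10 * x ^ 2)) ≤ Real.exp (-c) * Real.exp (1 / 2) := by
    rw [← Real.exp_add]
    exact Real.exp_le_exp.2 (by linarith)
  rw [hA]
  have h5 : Real.exp (-c) = (√(2 * Real.pi)) * ((√(2 * Real.pi))⁻¹ * Real.exp (-c)) := by
    field_simp
  set B := (√(2 * Real.pi))⁻¹ * Real.exp (-c)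
  have hB : 0 ≤ B := by positivity
  calc 1 / 5 * Real.exp (-(7 / 10 * x ^ 2)) ≤ 1 / 5 * (Real.exp (-c) * Real.exp (1 / 2)) := by
        linarith
    _ ≤ 1 / 5 * ((2.6 * B) * 1.7) := by
        have : Real.exp (-c) ≤ 2.6 * B := by
          rw [h5]; exact mul_le_mul_of_nonneg_right hs hB
        gcongr
    _ ≤ B := by linarith

lemma lintegral_exp_mul_sq_gaussianReal {b : ℝ} (hb : b < 1 / 2) :
    ∫⁻ z, ENNReal.ofReal (Real.exp (b * z ^ 2)) ∂(gaussianReal 0 1) =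
      ENNReal.ofReal (√(1 - 2 * b))⁻¹ := by
  have hd : ∀ z : ℝ, gaussianPDFReal 0 1 z * Real.exp (b * z ^ 2) =
      (√(2 * Real.pi))⁻¹ * Real.exp (-(1 / 2 - b) * z ^ 2) := by
    intro z
    simp only [gaussianPDFReal, NNReal.coe_one, mul_one, sub_zero]
    rw [mul_assoc, ← Real.exp_add]
    congr 2
    ring
  rw [gaussianReal_of_var_ne_zero 0 one_ne_zero,
    lintegral_withDensity_eq_lintegral_mul _ (measurable_gaussianPDF 0 1) (by fun_prop)]
  have : ∀ z, (gaussianPDF 0 1 * fun z => ENNReal.ofReal (Real.exp (b * z ^ 2))) z =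
      ENNReal.ofReal ((√(2 * Real.pi))⁻¹ * Real.exp (-(1 / 2 - b) * z ^ 2)) := by
    intro z
    rw [Pi.mul_apply, gaussianPDF, ← ENNReal.ofReal_mul (gaussianPDFReal_nonneg _ _ _), hd]
  simp_rw [this]
  rw [← ofReal_integral_eq_lintegral_ofReal
    ((integrable_exp_neg_mul_sq (by linarith)).const_mul _)
    (Filter.Eventually.of_forall fun z => by positivity), integral_const_mul, integral_gaussian]
  congr 1
  have hb' : 0 < 1 - 2 * b := by linarith
  rw [← Real.sqrt_inv, ← Real.sqrt_inv, ← Real.sqrt_mul (by positivity)]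
  congr 1
  have : (1 / 2 - b) ≠ 0 := by linarith
  field_simp

lemma gaussianReal_real_Ioi (m : ℝ) {V : ℝ} (hV : 0 < V) (a : ℝ) :
    (gaussianReal m V.toNNReal).real (Set.Ioi a) = gaussTail ((a - m) / √V) := by
  have hs : 0 < √V := Real.sqrt_pos.2 hV
  have h : gaussianReal m V.toNNReal =
      ((gaussianReal 0 1).map (fun x => √V * x)).map (fun x => x + m) := by
    rw [gaussianReal_map_const_mul, gaussianReal_map_add_const]
    congr 1
    · simp
    · ext
      simp [Real.sq_sqrt hV.le, hV.le]
  rw [h, map_measureReal_apply (by fun_prop) measurableSet_Ioi,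
    map_measureReal_apply (by fun_prop) (measurableSet_Ioi.preimage (by fun_prop))]
  unfold gaussTail
  congr 1
  ext x
  simp only [Set.mem_preimage, Set.mem_Ioi]
  rw [div_lt_iff₀ hs]
  constructor <;> intro h <;> linarith

lemma map_sum_const_mul_eq_gaussianReal {Ω : Type*} [MeasurableSpace Ω] {P : Measure Ω}
    [IsProbabilityMeasure P] {X : ℕ → Ω → ℝ} {m : ℝ} (hX : ∀ i, Measurable (X i))
    (hlaw : ∀ i, P.map (X i) = gaussianReal m 1) (hind : iIndepFun X P) (c : ℕ → ℝ) (n : ℕ) :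
    P.map (fun ω => ∑ i ∈ Finset.range n, c i * X i ω) =
      gaussianReal (∑ i ∈ Finset.range n, c i * m)
        (∑ i ∈ Finset.range n, c i ^ 2).toNNReal := by
  induction n with
  | zero => simp [gaussianReal_zero_var]
  | succ n ih =>
    have hi' : iIndepFun (fun i ω => c i * X i ω) P :=
      hind.comp (fun i x => c i * x) (fun i => by fun_prop)
    have hi := hi'.indepFun_finsetSum_of_notMem (s := Finset.range n) (i := n)
      (fun i => (hX i).const_mul _) (by simp)
    have hn : P.map (fun ω => c n * X n ω) =
        gaussianReal (c n * m) (c n ^ 2).toNNReal := by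
      have : (fun ω => c n * X n ω) = (fun x => c n * x) ∘ X n := rfl
      rw [this, ← Measure.map_map (by fun_prop) (hX n), hlaw, gaussianReal_map_const_mul]
      congr 1
      ext
      simp [sq_nonneg]
    have ih' : P.map (∑ i ∈ Finset.range n, fun ω => c i * X i ω) =
        gaussianReal (∑ i ∈ Finset.range n, c i * m)
          (∑ i ∈ Finset.range n, c i ^ 2).toNNReal := by
      rw [← ih]
      congr 1
      ext ω
      simp
    have h := gaussianReal_add_gaussianReal_of_indepFun hi ih' hn
    simp_rw [Finset.sum_range_succ]
    rw [Real.toNNReal_add (Finset.sum_nonneg fun i _ => sq_nonneg _) (sq_nonneg _), ← h]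
    congr 1
    ext ω
    simp

/-! ### The index of an arm given its rewards. -/

/-- Residual sum of squares of the first `s` rewards. -/
noncomputable def residualSS (y : ℕ → ℝ) (s : ℕ) : ℝ :=
  ∑ i ∈ Finset.range s, (y i - sampleMean y s) ^ 2

/-- Variance of the index of an arm given its rewards. -/
noncomputable def indexVar (σa : ℝ) (y : ℕ → ℝ) (s : ℕ) : ℝ :=
  residualSS y s / ((s : ℝ) + 2) ^ 2 + 2 * σa ^ 2 / ((s : ℝ) + 2)

/-- Probability, given the rewards, that the index of an arm exceeds `τ`. -/
noncomputable def exceedProb (σa τ : ℝ) (y : ℕ → ℝ) (s : ℕ) : ℝ :=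
  gaussTail ((τ - sampleMean y s) / √(indexVar σa y s))

lemma residualSS_nonneg (y : ℕ → ℝ) (s : ℕ) : 0 ≤ residualSS y s :=
  Finset.sum_nonneg fun _ _ => sq_nonneg _

/-- The sample mean minimizes the sum of squared deviations. With `m` the true mean, the right side
is a sum of independent squares, to which a Chernoff bound applies. -/
lemma residualSS_le (y : ℕ → ℝ) (s : ℕ) (m : ℝ) :
    residualSS y s ≤ ∑ i ∈ Finset.range s, (y i - m) ^ 2 := by
  rcases Nat.eq_zero_or_pos s with rfl | hs
  · simp [residualSS]
  have hs' : (s : ℝ) ≠ 0 := by positivity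
  have h1 : ∑ i ∈ Finset.range s, (y i - sampleMean y s) = 0 := by
    rw [Finset.sum_sub_distrib]
    simp only [Finset.sum_const, Finset.card_range, nsmul_eq_mul, sampleMean]
    field_simp
    ring
  have h2 : ∑ i ∈ Finset.range s, (y i - m) ^ 2 = residualSS y s +
      2 * (sampleMean y s - m) * ∑ i ∈ Finset.range s, (y i - sampleMean y s) +
      s * (sampleMean y s - m) ^ 2 := by
    rw [residualSS, Finset.mul_sum, ← Finset.sum_add_distrib]
    have : (s : ℝ) * (sampleMean y s - m) ^ 2 =
        ∑ i ∈ Finset.range s, (sampleMean y s - m) ^ 2 := by simp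
    rw [this, ← Finset.sum_add_distrib]
    exact Finset.sum_congr rfl fun i _ => by ring
  rw [h2, h1]
  have : 0 ≤ (s : ℝ) * (sampleMean y s - m) ^ 2 := by positivity
  linarith

lemma sum_residual_sq (σa : ℝ) (y : ℕ → ℝ) (s : ℕ) :
    ∑ i ∈ Finset.range (s + 2), (residual σa y s i / ((s : ℝ) + 2)) ^ 2 = indexVar σa y s := by
  have hs : (0 : ℝ) < (s : ℝ) + 2 := by positivity
  rw [Finset.sum_range_succ, Finset.sum_range_succ]
  have h1 : ∑ i ∈ Finset.range s, (residual σa y s i / ((s : ℝ) + 2)) ^ 2 =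
      residualSS y s / ((s : ℝ) + 2) ^ 2 := by
    rw [residualSS, Finset.sum_div]
    refine Finset.sum_congr rfl fun i hi => ?_
    rw [residual, if_pos (Finset.mem_range.1 hi), div_pow]
  have h2 : residual σa y s s = √((s : ℝ) + 2) * σa := by simp [residual]
  have h3 : residual σa y s (s + 1) = -(√((s : ℝ) + 2) * σa) := by simp [residual]
  rw [h1, h2, h3, indexVar, div_pow, div_pow, neg_sq, mul_pow, Real.sq_sqrt hs.le]
  field_simp
  ring

lemma armIndex_eq (σa : ℝ) (y : ℕ → ℝ) (s : ℕ) (w : ℕ → ℝ) :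
    armIndex σa y s w = sampleMean y s +
      ∑ i ∈ Finset.range (s + 2), residual σa y s i / ((s : ℝ) + 2) * w i := by
  rw [armIndex, Finset.sum_div]
  congr 1
  exact Finset.sum_congr rfl fun i _ => by ring

lemma le_indexVar (σa : ℝ) (y : ℕ → ℝ) (s : ℕ) :
    2 * σa ^ 2 / ((s : ℝ) + 2) ≤ indexVar σa y s := by
  have := residualSS_nonneg y s
  have : 0 ≤ residualSS y s / ((s : ℝ) + 2) ^ 2 := by positivity
  rw [indexVar]
  linarith

lemma indexVar_pos {σa : ℝ} (hσ : 0 < σa) (y : ℕ → ℝ) (s : ℕ) : 0 < indexVar σa y s :=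
  lt_of_lt_of_le (by positivity) (le_indexVar σa y s)

lemma indexVar_le {σa : ℝ} {y : ℕ → ℝ} {s : ℕ}
    (h : residualSS y s ≤ 2 * σa ^ 2 * ((s : ℝ) + 2)) :
    indexVar σa y s ≤ 4 * σa ^ 2 / ((s : ℝ) + 2) := by
  have hs : (0 : ℝ) < (s : ℝ) + 2 := by positivity
  have : residualSS y s / ((s : ℝ) + 2) ^ 2 ≤ 2 * σa ^ 2 / ((s : ℝ) + 2) := by
    rw [div_le_div_iff₀ (by positivity) hs]
    calc residualSS y s * ((s : ℝ) + 2) ≤ 2 * σa ^ 2 * ((s : ℝ) + 2) * ((s : ℝ) + 2) := by gcongr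
      _ = _ := by ring
  rw [indexVar]
  calc _ ≤ 2 * σa ^ 2 / ((s : ℝ) + 2) + 2 * σa ^ 2 / ((s : ℝ) + 2) := by gcongr
    _ = _ := by ring

/-- With the rewards frozen, the index is an affine function of independent standard normal weights.
-/
lemma measureReal_lt_armIndex {Ω : Type*} [MeasurableSpace Ω] {P : Measure Ω}
    [IsProbabilityMeasure P] {X : ℕ → Ω → ℝ} (hX : ∀ i, Measurable (X i))
    (hlaw : ∀ i, P.map (X i) = gaussianReal 0 1) (hind : iIndepFun X P)
    {σa : ℝ} (hσ : 0 < σa) (τ : ℝ) (y : ℕ → ℝ) (s : ℕ) :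
    P.real {ω | τ < armIndex σa y s (fun i => X i ω)} = exceedProb σa τ y s := by
  have h := map_sum_const_mul_eq_gaussianReal hX hlaw hind
    (fun i => residual σa y s i / ((s : ℝ) + 2)) (s + 2)
  rw [sum_residual_sq] at h
  simp only [mul_zero, Finset.sum_const_zero] at h
  have h2 := gaussianReal_real_Ioi 0 (indexVar_pos hσ y s) (τ - sampleMean y s)
  rw [← h, map_measureReal_apply (by fun_prop) measurableSet_Ioi, sub_zero] at h2
  rw [exceedProb, ← h2]
  congr 1
  ext ω
  simp only [Set.mem_ofPred_eq, armIndex_eq, Set.mem_preimage, Set.mem_Ioi]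
  constructor <;> intro h <;> linarith

lemma measurable_sampleMean (s : ℕ) : Measurable fun y : ℕ → ℝ => sampleMean y s := by
  unfold sampleMean
  fun_prop

lemma measurable_residualSS (s : ℕ) : Measurable fun y : ℕ → ℝ => residualSS y s := by
  have := measurable_sampleMean s
  unfold residualSS
  fun_prop

lemma measurable_exceedProb (σa τ : ℝ) (s : ℕ) :
    Measurable fun y : ℕ → ℝ => exceedProb σa τ y s := by
  have h1 := measurable_sampleMean s
  have h2 := measurable_residualSS s
  have h3 : Measurable fun y : ℕ → ℝ => indexVar σa y s := by
    unfold indexVar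
    fun_prop
  exact measurable_gaussTail.comp ((h1.const_sub _).div h3.sqrt)

lemma measurable_armIndex (σa : ℝ) (s : ℕ) :
    Measurable fun p : (ℕ → ℝ) × (ℕ → ℝ) => armIndex σa p.1 s p.2 := by
  have h1 : Measurable fun p : (ℕ → ℝ) × (ℕ → ℝ) => sampleMean p.1 s :=
    (measurable_sampleMean s).comp measurable_fst
  have h2 : ∀ i, Measurable fun p : (ℕ → ℝ) × (ℕ → ℝ) => residual σa p.1 s i := by
    intro i
    unfold residual
    split_ifs <;> fun_prop
  unfold armIndex
  fun_prop

/-- Origin of the constant `128`: a deviation `Δ / 4` and a variance at most `4 σa² / (s + 2)` give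
the exponent `Δ² (s + 2) / (16 * 8 σa²)`. -/
lemma exp_neg_le_of_gap {σa Δ ℓ u V : ℝ} {s : ℕ}
    (hV0 : 0 < V) (hV : V ≤ 4 * σa ^ 2 / ((s : ℝ) + 2)) (hu : (Δ / 4) ^ 2 ≤ u ^ 2)
    (hℓ : 128 * σa ^ 2 * ℓ ≤ Δ ^ 2 * ((s : ℝ) + 2)) :
    Real.exp (-((u / √V) ^ 2 / 2)) ≤ Real.exp (-ℓ) := by
  rw [Real.exp_le_exp, neg_le_neg_iff, div_pow, Real.sq_sqrt hV0.le]
  have hs : (0 : ℝ) < (s : ℝ) + 2 := by positivity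
  rw [le_div_iff₀ hs] at hV
  rw [div_div, le_div_iff₀ (by positivity)]
  rcases le_or_gt ℓ 0 with h | h
  · have : ℓ * (V * 2) ≤ 0 := mul_nonpos_of_nonpos_of_nonneg h (by positivity)
    have := sq_nonneg u
    linarith
  · refine le_trans ?_ hu
    have h1 : ℓ * (V * ((s : ℝ) + 2)) ≤ ℓ * (4 * σa ^ 2) := by gcongr
    have h2 : ℓ * (V * 2) * ((s : ℝ) + 2) ≤ (Δ / 4) ^ 2 * ((s : ℝ) + 2) := by
      calc _ = 2 * (ℓ * (V * ((s : ℝ) + 2))) := by ring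
        _ ≤ 2 * (ℓ * (4 * σa ^ 2)) := by linarith
        _ = (128 * σa ^ 2 * ℓ) / 16 := by ring
        _ ≤ (Δ ^ 2 * ((s : ℝ) + 2)) / 16 := by linarith
        _ = _ := by ring
    exact le_of_mul_le_mul_right h2 hs

section Bounds

variable {σa Δ : ℝ} {y : ℕ → ℝ} {s T : ℕ} {m : ℝ}

lemma exp_neg_log_natCast (hT : 2 ≤ T) : Real.exp (-Real.log T) = (T : ℝ)⁻¹ := by
  rw [Real.exp_neg, Real.exp_log (by positivity)]

lemma exceedProb_le_inv (hσ : 0 < σa) (hΔ : 0 < Δ) (hT : 2 ≤ T)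
    (hs : 128 * σa ^ 2 * Real.log T ≤ Δ ^ 2 * ((s : ℝ) + 2))
    (hm : sampleMean y s ≤ m + Δ / 4) (hR : residualSS y s ≤ 2 * σa ^ 2 * ((s : ℝ) + 2)) :
    exceedProb σa (m + Δ / 2) y s ≤ (T : ℝ)⁻¹ := by
  have hV0 := indexVar_pos hσ y s
  refine (gaussTail_le_exp (div_nonneg (by linarith) (Real.sqrt_nonneg _))).trans ?_
  rw [← exp_neg_log_natCast hT]
  exact exp_neg_le_of_gap hV0 (indexVar_le hR)
    (pow_le_pow_left₀ (by positivity) (by linarith) 2) hs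

lemma exceedProb_pos (σa τ : ℝ) (y : ℕ → ℝ) (s : ℕ) : 0 < exceedProb σa τ y s :=
  lt_of_lt_of_le (by positivity) (le_gaussTail _)

lemma exceedProb_le_one (σa τ : ℝ) (y : ℕ → ℝ) (s : ℕ) : exceedProb σa τ y s ≤ 1 :=
  gaussTail_le_one _

lemma half_le_exceedProb {τ : ℝ} (h : τ ≤ sampleMean y s) : 1 / 2 ≤ exceedProb σa τ y s :=
  half_le_gaussTail (div_nonpos_of_nonpos_of_nonneg (by linarith) (Real.sqrt_nonneg _))

lemma inv_exceedProb_le_two {τ : ℝ} (h : τ ≤ sampleMean y s) : (exceedProb σa τ y s)⁻¹ ≤ 2 := by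
  have := half_le_exceedProb (σa := σa) h
  rw [inv_le_comm₀ (exceedProb_pos _ _ _ _) (by norm_num)]
  linarith

lemma inv_exceedProb_sub_one_le (hσ : 0 < σa) (hΔ : 0 < Δ) (hT : 2 ≤ T)
    (hs : 128 * σa ^ 2 * Real.log T ≤ Δ ^ 2 * ((s : ℝ) + 2))
    (hm : m - sampleMean y s ≤ Δ / 4) (hR : residualSS y s ≤ 2 * σa ^ 2 * ((s : ℝ) + 2)) :
    (exceedProb σa (m - Δ / 2) y s)⁻¹ - 1 ≤ 2 / T := by
  have hV0 := indexVar_pos hσ y s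
  have h2 := inv_exceedProb_le_two (σa := σa) (y := y) (s := s) (τ := m - Δ / 2) (by linarith)
  have hpos := exceedProb_pos σa (m - Δ / 2) y s
  have h1 : 1 - exceedProb σa (m - Δ / 2) y s ≤ (T : ℝ)⁻¹ := by
    refine (one_sub_gaussTail_le_exp
      (div_nonpos_of_nonpos_of_nonneg (by linarith) (Real.sqrt_nonneg _))).trans ?_
    rw [← exp_neg_log_natCast hT]
    refine exp_neg_le_of_gap hV0 (indexVar_le hR) ?_ hs
    rw [← neg_sq (m - Δ / 2 - sampleMean y s)]
    exact pow_le_pow_left₀ (by positivity) (by linarith) 2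
  have h3 : (exceedProb σa (m - Δ / 2) y s)⁻¹ - 1 =
      (exceedProb σa (m - Δ / 2) y s)⁻¹ * (1 - exceedProb σa (m - Δ / 2) y s) := by
    rw [mul_sub, mul_one, inv_mul_cancel₀ hpos.ne']
  rw [h3, div_eq_mul_inv]
  exact mul_le_mul h2 h1 (sub_nonneg.2 (exceedProb_le_one _ _ _ _)) (by norm_num)

/-- The lower bound on the variance controls how unlikely exploration can become when the sample
mean is too low. The constant is `7 / 10` from the tail bound, halved by the variance bound, times
`3` from `s + 2 ≤ 3 s`. The term `-Δ² / 4` supplies the decay in `s` needed beyond the threshold. -/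
lemma inv_exceedProb_le_exp (hσ : 0 < σa) (hΔ : 0 < Δ) (hs : 1 ≤ s)
    (hm : Δ / 2 ≤ m - sampleMean y s) :
    (exceedProb σa (m - Δ / 2) y s)⁻¹ ≤
      5 * Real.exp (21 / 20 / σa ^ 2 * (s * ((m - sampleMean y s) ^ 2 - Δ ^ 2 / 4))) := by
  have hV0 := indexVar_pos hσ y s
  have hs2 : (0 : ℝ) < (s : ℝ) + 2 := by positivity
  have hs1 : (1 : ℝ) ≤ s := by exact_mod_cast hs
  set x := (m - Δ / 2 - sampleMean y s) / √(indexVar σa y s) with hx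
  have h1 : 7 / 10 * x ^ 2 ≤
      21 / 20 / σa ^ 2 * (s * ((m - sampleMean y s) ^ 2 - Δ ^ 2 / 4)) := by
    rw [hx, div_pow, Real.sq_sqrt hV0.le]
    have hV := le_indexVar σa y s
    have ha : (m - Δ / 2 - sampleMean y s) ^ 2 / indexVar σa y s ≤
        (m - Δ / 2 - sampleMean y s) ^ 2 / (2 * σa ^ 2 / ((s : ℝ) + 2)) := by
      gcongr
    have hb : (m - Δ / 2 - sampleMean y s) ^ 2 ≤ (m - sampleMean y s) ^ 2 - Δ ^ 2 / 4 := by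
      nlinarith
    have hb0 := (sq_nonneg _).trans hb
    calc _ ≤ 7 / 10 * ((m - Δ / 2 - sampleMean y s) ^ 2 / (2 * σa ^ 2 / ((s : ℝ) + 2))) := by
          linarith
      _ = 7 / 20 / σa ^ 2 * (((s : ℝ) + 2) * (m - Δ / 2 - sampleMean y s) ^ 2) := by
          field_simp
          ring
      _ ≤ 7 / 20 / σa ^ 2 * ((3 * s) * ((m - sampleMean y s) ^ 2 - Δ ^ 2 / 4)) := by
          gcongr
          linarith
      _ = _ := by ring
  have h2 := le_gaussTail x
  rw [inv_le_comm₀ (exceedProb_pos _ _ _ _) (by positivity)]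
  refine le_trans ?_ h2
  rw [mul_inv, ← Real.exp_neg]
  have := Real.exp_le_exp.2 (neg_le_neg h1)
  linarith

end Bounds

lemma integrable_exp_mul_sq_gaussianReal {b : ℝ} (hb : b < 1 / 2) :
    Integrable (fun z => Real.exp (b * z ^ 2)) (gaussianReal 0 1) := by
  refine ⟨by fun_prop, ?_⟩
  rw [hasFiniteIntegral_iff_ofReal (Filter.Eventually.of_forall fun z => (Real.exp_pos _).le),
    lintegral_exp_mul_sq_gaussianReal hb]
  exact ENNReal.ofReal_lt_top

lemma integral_exp_mul_sq_gaussianReal {b : ℝ} (hb : b < 1 / 2) :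
    ∫ z, Real.exp (b * z ^ 2) ∂(gaussianReal 0 1) = (√(1 - 2 * b))⁻¹ := by
  rw [integral_eq_lintegral_of_nonneg_ae
    (Filter.Eventually.of_forall fun z => (Real.exp_pos _).le) (by fun_prop),
    lintegral_exp_mul_sq_gaussianReal hb, ENNReal.toReal_ofReal (by positivity)]

lemma lintegral_comp_neg_gaussianReal {f : ℝ → ENNReal} (hf : Measurable f) :
    ∫⁻ z, f (-z) ∂(gaussianReal 0 1) = ∫⁻ z, f z ∂(gaussianReal 0 1) := by
  have h := gaussianReal_map_neg (μ := 0) (v := 1)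
  rw [neg_zero] at h
  conv_rhs => rw [← h, lintegral_map hf (by fun_prop)]

/-! ### Averages over the rewards of a single arm. -/

section Sample

variable {Ω : Type*} [MeasurableSpace Ω] {P : Measure Ω} [IsProbabilityMeasure P]
  {X : ℕ → Ω → ℝ} {m : ℝ}

lemma map_sqrt_mul_sub_sampleMean (hX : ∀ i, Measurable (X i))
    (hlaw : ∀ i, P.map (X i) = gaussianReal m 1) (hind : iIndepFun X P) {s : ℕ} (hs : 1 ≤ s) :
    P.map (fun ω => √(s : ℝ) * (m - sampleMean (fun i => X i ω) s)) = gaussianReal 0 1 := by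
  have hs0 : (0 : ℝ) < s := by exact_mod_cast hs
  have hsq : √(s : ℝ) * √(s : ℝ) = s := Real.mul_self_sqrt hs0.le
  have h := map_sum_const_mul_eq_gaussianReal hX hlaw hind (fun _ => -(√(s : ℝ) / s)) s
  have h2 : (fun ω => √(s : ℝ) * (m - sampleMean (fun i => X i ω) s)) =
      (fun x => √(s : ℝ) * m + x) ∘
        fun ω => ∑ i ∈ Finset.range s, -(√(s : ℝ) / s) * X i ω := by
    ext ω
    simp only [sampleMean, Function.comp_apply, ← Finset.mul_sum]
    ring
  rw [h2, ← Measure.map_map (by fun_prop) (by fun_prop), h, gaussianReal_map_const_add]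
  congr 1
  · simp
    field_simp
    ring
  · ext
    simp only [neg_sq, Finset.sum_const, Finset.card_range, nsmul_eq_mul, NNReal.coe_one]
    rw [Real.coe_toNNReal _ (by positivity), div_pow, Real.sq_sqrt hs0.le]
    field_simp

lemma measurable_sampleMean_comp (hX : ∀ i, Measurable (X i)) (s : ℕ) :
    Measurable fun ω => sampleMean (fun i => X i ω) s :=
  (measurable_sampleMean s).comp (measurable_pi_lambda _ hX)

lemma measureReal_lt_sub_sampleMean (hX : ∀ i, Measurable (X i))
    (hlaw : ∀ i, P.map (X i) = gaussianReal m 1) (hind : iIndepFun X P) {s : ℕ} (hs : 1 ≤ s)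
    (a : ℝ) :
    P.real {ω | a < m - sampleMean (fun i => X i ω) s} = gaussTail (√(s : ℝ) * a) := by
  have hs0 : (0 : ℝ) < √(s : ℝ) := Real.sqrt_pos.2 (by exact_mod_cast hs)
  have hM := measurable_sampleMean_comp hX s
  rw [gaussTail, ← map_sqrt_mul_sub_sampleMean hX hlaw hind hs,
    map_measureReal_apply (by fun_prop) measurableSet_Ioi]
  congr 1
  ext ω
  simp [mul_lt_mul_iff_right₀ hs0]

lemma measureReal_lt_sampleMean_sub (hX : ∀ i, Measurable (X i))
    (hlaw : ∀ i, P.map (X i) = gaussianReal m 1) (hind : iIndepFun X P) {s : ℕ} (hs : 1 ≤ s)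
    (a : ℝ) :
    P.real {ω | a < sampleMean (fun i => X i ω) s - m} = gaussTail (√(s : ℝ) * a) := by
  have hs0 : (0 : ℝ) < √(s : ℝ) := Real.sqrt_pos.2 (by exact_mod_cast hs)
  have hM := measurable_sampleMean_comp hX s
  have h := gaussianReal_map_neg (μ := 0) (v := 1)
  rw [neg_zero] at h
  rw [gaussTail, ← h, ← map_sqrt_mul_sub_sampleMean hX hlaw hind hs,
    map_measureReal_apply (by fun_prop) measurableSet_Ioi,
    map_measureReal_apply (by fun_prop) (measurableSet_Ioi.preimage (by fun_prop))]
  congr 1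
  ext ω
  simp only [Set.mem_ofPred_eq, Set.mem_preimage, Set.mem_Ioi]
  rw [← mul_neg, mul_lt_mul_iff_right₀ hs0, neg_sub]

/-- Chernoff bound at parameter `1 / 4` for a chi-square sum, each square having exponential moment
`√2`. Since `σa² ≥ 9 / 4`, the exponent is at least `(9 / 8) (s + 2)`, which beats `√2 ^ s`. -/
lemma measureReal_lt_residualSS_le (hX : ∀ i, Measurable (X i))
    (hlaw : ∀ i, P.map (X i) = gaussianReal m 1) (hind : iIndepFun X P) {σa : ℝ}
    (hσ : 1.5 < σa) (s : ℕ) :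
    P.real {ω | 2 * σa ^ 2 * ((s : ℝ) + 2) < residualSS (fun i => X i ω) s} ≤
      1 / 8 * (1 / 2) ^ s := by
  have hlaw' : ∀ i, P.map (fun ω => X i ω - m) = gaussianReal 0 1 := by
    intro i
    have : (fun ω => X i ω - m) = (fun x => x - m) ∘ X i := rfl
    rw [this, ← Measure.map_map (by fun_prop) (hX i), hlaw, gaussianReal_map_sub_const, sub_self]
  have hind' : iIndepFun (fun i ω => (X i ω - m) ^ 2) P :=
    hind.comp (fun i x => (x - m) ^ 2) (fun i => by fun_prop)
  have hmeas : ∀ i, Measurable fun ω => (X i ω - m) ^ 2 := fun i => by fun_prop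
  have hmgf : ∀ i, mgf (fun ω => (X i ω - m) ^ 2) P (1 / 4) = √2 := by
    intro i
    rw [mgf]
    have h := integral_exp_mul_sq_gaussianReal (b := 1 / 4) (by norm_num)
    rw [← hlaw' i, integral_map (by fun_prop) (by fun_prop)] at h
    rw [h, ← Real.sqrt_inv]
    norm_num
  have hint : ∀ i, Integrable (fun ω => Real.exp (1 / 4 * (X i ω - m) ^ 2)) P := by
    intro i
    have h := integrable_exp_mul_sq_gaussianReal (b := 1 / 4) (by norm_num)
    rw [← hlaw' i] at h
    exact h.comp_measurable (by fun_prop)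
  have hch := measure_ge_le_exp_mul_mgf (μ := P)
    (X := ∑ i ∈ Finset.range s, fun ω => (X i ω - m) ^ 2) (t := 1 / 4)
    (2 * σa ^ 2 * ((s : ℝ) + 2)) (by norm_num)
    (hind'.integrable_exp_mul_sum hmeas fun i _ => hint i)
  rw [hind'.mgf_sum hmeas, Finset.prod_congr rfl fun i _ => hmgf i, Finset.prod_const,
    Finset.card_range] at hch
  refine (measureReal_mono ?_).trans (hch.trans ?_)
  · intro ω hω
    simp only [Set.mem_ofPred_eq, Finset.sum_apply] at hω ⊢
    exact hω.le.trans (residualSS_le _ _ _)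
  · have he : Real.exp (-(9 / 8)) * √2 ≤ 1 / 2 ∧ Real.exp (-(9 / 4)) ≤ 1 / 8 := by
      have h1 : (8 : ℝ) ≤ Real.exp (9 / 4) := by
        have h := Real.exp_one_gt_d9
        have h2 := Real.add_one_le_exp (1 / 4 : ℝ)
        have h3 : Real.exp (9 / 4) = Real.exp 1 * Real.exp 1 * Real.exp (1 / 4) := by
          rw [← Real.exp_add, ← Real.exp_add]
          norm_num
        rw [h3]
        nlinarith
      have h4 : Real.exp (-(9 / 4)) ≤ 1 / 8 := by
        rw [Real.exp_neg, one_div]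
        exact inv_anti₀ (by norm_num) h1
      refine ⟨?_, h4⟩
      -- Squaring reduces the first bound to the second: `exp (-9/4) * 2 ≤ 1 / 4`.
      refine abs_le_of_sq_le_sq' ?_ (by norm_num) |>.2
      rw [mul_pow, Real.sq_sqrt (by norm_num), ← Real.exp_nat_mul]
      norm_num
      norm_num at h4
      linarith
    have hq : (9 / 4 : ℝ) ≤ σa ^ 2 := by nlinarith
    have hs0 : (0 : ℝ) ≤ s := Nat.cast_nonneg s
    calc Real.exp (-(1 / 4) * (2 * σa ^ 2 * ((s : ℝ) + 2))) * √2 ^ s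
        ≤ Real.exp (-(9 / 4) + s * -(9 / 8)) * √2 ^ s := by
          gcongr
          nlinarith
      _ = Real.exp (-(9 / 4)) * (Real.exp (-(9 / 8)) * √2) ^ s := by
          rw [Real.exp_add, Real.exp_nat_mul, mul_pow]
          ring
      _ ≤ 1 / 8 * (1 / 2) ^ s := by
          have := he.1
          have := he.2
          gcongr

lemma gaussTail_sqrt_mul_le {σa Δ : ℝ} {s T : ℕ} (hσ : 1.5 < σa) (hΔ : 0 < Δ) (hs : 1 ≤ s)
    (hT : 2 ≤ T) (h : 128 * σa ^ 2 * Real.log T ≤ Δ ^ 2 * ((s : ℝ) + 2)) :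
    gaussTail (√(s : ℝ) * (Δ / 4)) ≤ 1 / 4 * (T : ℝ)⁻¹ := by
  have hT' : (2 : ℝ) ≤ T := by exact_mod_cast hT
  have hs' : (1 : ℝ) ≤ s := by exact_mod_cast hs
  have hq : (9 / 4 : ℝ) ≤ σa ^ 2 := by nlinarith
  have hℓ : 0 ≤ Real.log T := Real.log_nonneg (by linarith)
  refine (gaussTail_le_exp (by positivity)).trans ?_
  rw [mul_pow, Real.sq_sqrt (by linarith)]
  -- Three logarithms give `T⁻³`, of which two factors are spent on the constant `1 / 4`, using `T ≥
  -- 2`.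
  have h1 : 3 * Real.log T ≤ s * (Δ / 4) ^ 2 / 2 := by
    have h2 : 128 * (9 / 4) * Real.log T ≤ 128 * σa ^ 2 * Real.log T := by gcongr
    have h3 : Δ ^ 2 * ((s : ℝ) + 2) ≤ Δ ^ 2 * (3 * s) := by gcongr; linarith
    linarith
  calc Real.exp (-(s * (Δ / 4) ^ 2 / 2)) ≤ Real.exp ((3 : ℕ) * -Real.log T) := by
        rw [Real.exp_le_exp]
        push_cast
        linarith
    _ = ((T : ℝ)⁻¹) ^ 2 * (T : ℝ)⁻¹ := by
        rw [Real.exp_nat_mul, exp_neg_log_natCast hT]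
        ring
    _ ≤ (1 / 2) ^ 2 * (T : ℝ)⁻¹ := by
        have : (T : ℝ)⁻¹ ≤ 1 / 2 := by
          rw [one_div]
          exact inv_anti₀ (by norm_num) hT'
        gcongr
    _ = _ := by norm_num

lemma measureReal_inv_lt_exceedProb_le (hX : ∀ i, Measurable (X i))
    (hlaw : ∀ i, P.map (X i) = gaussianReal m 1) (hind : iIndepFun X P) {σa Δ : ℝ} {s T : ℕ}
    (hσ : 1.5 < σa) (hΔ : 0 < Δ) (hs : 1 ≤ s) (hT : 2 ≤ T)
    (h : 128 * σa ^ 2 * Real.log T ≤ Δ ^ 2 * ((s : ℝ) + 2)) :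
    P.real {ω | (T : ℝ)⁻¹ < exceedProb σa (m + Δ / 2) (fun i => X i ω) s} ≤
      1 / 4 * (T : ℝ)⁻¹ + 1 / 8 * (1 / 2) ^ s := by
  have h1 := (measureReal_lt_sampleMean_sub hX hlaw hind hs (Δ / 4)).trans_le
    (gaussTail_sqrt_mul_le hσ hΔ hs hT h)
  have h2 := measureReal_lt_residualSS_le hX hlaw hind hσ s
  refine (measureReal_mono ?_).trans ((measureReal_union_le _ _).trans (add_le_add h1 h2))
  intro ω hω
  by_contra hc
  simp only [Set.mem_union, Set.mem_ofPred_eq, not_or, not_lt] at hc hω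
  exact absurd hω (not_lt.2 (exceedProb_le_inv (by linarith) hΔ hT h (by linarith) hc.2))

/-- Everything is dominated by a function `h` of the standardized sample mean: `1` on the favourable
side, where the exceedance probability is at least `1 / 2`, and `5 exp (b z²) - 1` on the other. The
resulting bound does not depend on `s`. -/
lemma lintegral_inv_exceedProb_sub_one_le (hX : ∀ i, Measurable (X i))
    (hlaw : ∀ i, P.map (X i) = gaussianReal m 1) (hind : iIndepFun X P) {σa Δ : ℝ} {s : ℕ}
    (hσ : 1.5 < σa) (hΔ : 0 < Δ) (hs : 1 ≤ s) :
    ∫⁻ ω, ENNReal.ofReal ((exceedProb σa (m - Δ / 2) (fun i => X i ω) s)⁻¹ - 1) ∂P ≤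
      ENNReal.ofReal (2.1 + 2 * (1 - 2.25 * (σa ^ 2)⁻¹) ^ (-(1 / 2) : ℝ)) := by
  set b : ℝ := 21 / 20 / σa ^ 2 with hb
  have hq : (9 / 4 : ℝ) < σa ^ 2 := by nlinarith
  have hb2 : b < 7 / 15 := by
    rw [hb, div_lt_iff₀ (by linarith)]
    linarith
  have hs0 : (0 : ℝ) < s := by exact_mod_cast hs
  have hb0 : 0 ≤ b := by positivity
  set h : ℝ → ENNReal := fun z =>
    if z ≤ 0 then 1 else ENNReal.ofReal (5 * Real.exp (b * z ^ 2) - 1) with hh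
  have hhm : Measurable h :=
    Measurable.ite measurableSet_Iic measurable_const (by fun_prop)
  have hM := measurable_sampleMean_comp hX s
  have h1 : ∫⁻ ω, ENNReal.ofReal ((exceedProb σa (m - Δ / 2) (fun i => X i ω) s)⁻¹ - 1) ∂P ≤
      ∫⁻ z, h z ∂(gaussianReal 0 1) := by
    rw [← map_sqrt_mul_sub_sampleMean hX hlaw hind hs, lintegral_map hhm (by fun_prop)]
    refine lintegral_mono fun ω => ?_
    set G := m - sampleMean (fun i => X i ω) s with hG
    simp only [hh, mul_pow, Real.sq_sqrt hs0.le]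
    have hpos := exceedProb_pos σa (m - Δ / 2) (fun i => X i ω) s
    split_ifs with hz
    · have hG0 : G ≤ 0 := by
        by_contra hc
        exact absurd hz (not_le.2 (mul_pos (Real.sqrt_pos.2 hs0) (not_le.1 hc)))
      have := inv_exceedProb_le_two (σa := σa) (y := fun i => X i ω) (s := s)
        (τ := m - Δ / 2) (by linarith)
      rw [← ENNReal.ofReal_one]
      exact ENNReal.ofReal_le_ofReal (by linarith)
    · refine ENNReal.ofReal_le_ofReal (sub_le_sub_right ?_ _)
      rcases le_or_gt (Δ / 2) G with hc | hc
      · refine (inv_exceedProb_le_exp (by linarith) hΔ hs hc).trans ?_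
        rw [← hG, ← hb]
        gcongr
        have := sq_nonneg Δ
        linarith
      · have := inv_exceedProb_le_two (σa := σa) (y := fun i => X i ω) (s := s)
          (τ := m - Δ / 2) (by linarith)
        have h3 := Real.one_le_exp (show 0 ≤ b * (s * G ^ 2) by positivity)
        linarith
  -- By symmetry of the normal law it is enough that `h z + h (-z) ≤ 5 exp (b z²)`; for `z ≠ 0` the
  -- `1` and the `-1` cancel.
  have h2 : ∫⁻ z, h z ∂(gaussianReal 0 1) + ∫⁻ z, h z ∂(gaussianReal 0 1) ≤
      ENNReal.ofReal (5 * (√(1 - 2 * b))⁻¹) := by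
    conv_lhs => rw [← lintegral_comp_neg_gaussianReal hhm, lintegral_comp_neg_gaussianReal hhm]
    nth_rewrite 2 [← lintegral_comp_neg_gaussianReal hhm]
    rw [← lintegral_add_left hhm, ENNReal.ofReal_mul (by norm_num),
      ← lintegral_exp_mul_sq_gaussianReal (by linarith), ← lintegral_const_mul _ (by fun_prop)]
    refine lintegral_mono fun z => ?_
    have he := Real.one_le_exp (show 0 ≤ b * z ^ 2 by positivity)
    rw [← ENNReal.ofReal_mul (by norm_num)]
    simp only [hh, neg_sq, ← ENNReal.ofReal_one]
    split_ifs
    · rw [← ENNReal.ofReal_add (by norm_num) (by norm_num)]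
      exact ENNReal.ofReal_le_ofReal (by linarith)
    · rw [← ENNReal.ofReal_add (by norm_num) (by linarith)]
      exact ENNReal.ofReal_le_ofReal (by linarith)
    · rw [← ENNReal.ofReal_add (by linarith) (by norm_num)]
      exact ENNReal.ofReal_le_ofReal (by linarith)
    · exfalso
      linarith
  -- Four of the five copies are compared with `2.25 / σa²` in place of `2 b`; the fifth is at most
  -- `4 ≤ 4.2`, as `1 - 2 b ≥ 1 / 15`.
  have h3 : 5 * (√(1 - 2 * b))⁻¹ ≤
      2 * (2.1 + 2 * (1 - 2.25 * (σa ^ 2)⁻¹) ^ (-(1 / 2) : ℝ)) := by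
    have hq' : 2.25 * (σa ^ 2)⁻¹ < 1 := by
      rw [← div_eq_mul_inv, div_lt_one (by linarith)]
      norm_num
      linarith
    have hbq : 2 * b ≤ 2.25 * (σa ^ 2)⁻¹ := by
      rw [hb, ← div_eq_mul_inv, mul_div_assoc']
      gcongr
      norm_num
    rw [Real.rpow_neg (by linarith), ← Real.sqrt_eq_rpow]
    have h4 : (√(1 - 2 * b))⁻¹ ≤ (√(1 - 2.25 * (σa ^ 2)⁻¹))⁻¹ :=
      inv_anti₀ (Real.sqrt_pos.2 (by linarith)) (Real.sqrt_le_sqrt (by linarith))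
    have h5 : (√(1 - 2 * b))⁻¹ ≤ 4 := by
      rw [inv_le_comm₀ (Real.sqrt_pos.2 (by linarith)) (by norm_num)]
      refine Real.le_sqrt_of_sq_le ?_
      norm_num
      linarith
    linarith
  have h4 : 2 * ∫⁻ z, h z ∂(gaussianReal 0 1) ≤
      2 * ENNReal.ofReal (2.1 + 2 * (1 - 2.25 * (σa ^ 2)⁻¹) ^ (-(1 / 2) : ℝ)) := by
    rw [two_mul]
    refine h2.trans ((ENNReal.ofReal_le_ofReal h3).trans (le_of_eq ?_))
    rw [ENNReal.ofReal_mul (by norm_num)]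
    norm_num
  exact h1.trans ((ENNReal.mul_le_mul_iff_right (by norm_num) (by norm_num)).1 h4)

/-- A sample mean lower than `m - Δ / 2` is handled by the exponential moment, now with the small
prefactor `c`. Otherwise the integrand is at most `1`, and at most `2 / T` off the events `A` (large
residuals) and `B` (low mean). The coefficient `13 / 4` is `2 + 1 / 4 + 1`. -/
lemma lintegral_inv_exceedProb_sub_one_le_of_gap (hX : ∀ i, Measurable (X i))
    (hlaw : ∀ i, P.map (X i) = gaussianReal m 1) (hind : iIndepFun X P) {σa Δ : ℝ} {s T : ℕ}
    (hσ : 1.5 < σa) (hΔ : 0 < Δ) (hs : 1 ≤ s) (hT : 2 ≤ T)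
    (h : 128 * σa ^ 2 * Real.log T ≤ Δ ^ 2 * ((s : ℝ) + 2)) :
    ∫⁻ ω, ENNReal.ofReal ((exceedProb σa (m - Δ / 2) (fun i => X i ω) s)⁻¹ - 1) ∂P ≤
      ENNReal.ofReal (13 / 4 * (T : ℝ)⁻¹ + 1 / 8 * (1 / 2) ^ s) := by
  set b : ℝ := 21 / 20 / σa ^ 2 with hb
  have hT' : (2 : ℝ) ≤ T := by exact_mod_cast hT
  have hs' : (1 : ℝ) ≤ s := by exact_mod_cast hs
  have hq : (9 / 4 : ℝ) < σa ^ 2 := by nlinarith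
  have hℓ : 0 ≤ Real.log T := Real.log_nonneg (by linarith)
  have hb2 : b < 7 / 15 := by
    rw [hb, div_lt_iff₀ (by linarith)]
    linarith
  have hM := measurable_sampleMean_comp hX s
  have hR : Measurable fun ω => residualSS (fun i => X i ω) s :=
    (measurable_residualSS s).comp (measurable_pi_lambda _ hX)
  set A : Set Ω := {ω | 2 * σa ^ 2 * ((s : ℝ) + 2) < residualSS (fun i => X i ω) s} with hA
  set B : Set Ω := {ω | Δ / 4 < m - sampleMean (fun i => X i ω) s} with hB
  have hAm : MeasurableSet A := measurableSet_lt measurable_const hR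
  have hBm : MeasurableSet B := measurableSet_lt measurable_const (by fun_prop)
  have h1 := measureReal_lt_residualSS_le hX hlaw hind hσ s
  have h2 := (measureReal_lt_sub_sampleMean hX hlaw hind hs (Δ / 4)).trans_le
    (gaussTail_sqrt_mul_le hσ hΔ hs hT h)
  set c : ℝ := 5 * Real.exp (-(b * (s * (Δ ^ 2 / 4)))) with hc
  have hE : ∫⁻ ω, ENNReal.ofReal
      (c * Real.exp (b * (√(s : ℝ) * (m - sampleMean (fun i => X i ω) s)) ^ 2)) ∂P =
      ENNReal.ofReal (c * (√(1 - 2 * b))⁻¹) := by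
    have hc0 : 0 ≤ c := by positivity
    simp_rw [ENNReal.ofReal_mul hc0]
    rw [lintegral_const_mul _ (by fun_prop),
      ← lintegral_exp_mul_sq_gaussianReal (by linarith),
      ← map_sqrt_mul_sub_sampleMean hX hlaw hind hs, lintegral_map (by fun_prop) (by fun_prop)]
  have hcT : c * (√(1 - 2 * b))⁻¹ ≤ (T : ℝ)⁻¹ := by
    have h5 : (√(1 - 2 * b))⁻¹ ≤ 4 := by
      rw [inv_le_comm₀ (Real.sqrt_pos.2 (by linarith)) (by norm_num)]
      refine Real.le_sqrt_of_sq_le ?_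
      norm_num
      linarith
    -- Six logarithms suffice: the constant `5 * 4` is absorbed by `T⁻⁵ ≤ 1 / 32`.
    have h6 : 6 * Real.log T ≤ b * (s * (Δ ^ 2 / 4)) := by
      have h3 : Δ ^ 2 * ((s : ℝ) + 2) ≤ Δ ^ 2 * (3 * s) := by gcongr; linarith
      have h4 : 128 / 12 * σa ^ 2 * Real.log T ≤ s * (Δ ^ 2 / 4) := by linarith
      calc 6 * Real.log T ≤ 11.2 * Real.log T := by
            gcongr
            norm_num
        _ = b * (128 / 12 * σa ^ 2 * Real.log T) := by
            rw [hb]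
            field_simp
            ring
        _ ≤ _ := by gcongr
    have h7 : Real.exp (-(b * (s * (Δ ^ 2 / 4)))) ≤ ((T : ℝ)⁻¹) ^ 6 := by
      rw [← exp_neg_log_natCast hT, ← Real.exp_nat_mul, Real.exp_le_exp]
      push_cast
      linarith
    have h8 : (T : ℝ)⁻¹ ≤ 1 / 2 := by
      rw [one_div]
      exact inv_anti₀ (by norm_num) hT'
    calc c * (√(1 - 2 * b))⁻¹ ≤ 5 * ((T : ℝ)⁻¹) ^ 6 * 4 := by
          rw [hc]
          gcongr
      _ = 20 * ((T : ℝ)⁻¹) ^ 5 * (T : ℝ)⁻¹ := by ring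
      _ ≤ 20 * (1 / 2) ^ 5 * (T : ℝ)⁻¹ := by gcongr
      _ ≤ 1 * (T : ℝ)⁻¹ := by
          gcongr
          norm_num
      _ = _ := one_mul _
  have hpt : ∀ ω, ENNReal.ofReal ((exceedProb σa (m - Δ / 2) (fun i => X i ω) s)⁻¹ - 1) ≤
      ENNReal.ofReal (2 / T) + (A.indicator 1 ω + (B.indicator 1 ω + ENNReal.ofReal
        (c * Real.exp (b * (√(s : ℝ) * (m - sampleMean (fun i => X i ω) s)) ^ 2)))) := by
    intro ω
    rcases le_or_gt (Δ / 2) (m - sampleMean (fun i => X i ω) s) with hG | hG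
    · refine le_trans ?_ (le_add_left (le_add_left (le_add_left le_rfl)))
      have := inv_exceedProb_le_exp (by linarith) hΔ hs hG (σa := σa)
      refine ENNReal.ofReal_le_ofReal ?_
      rw [hc, mul_assoc, ← Real.exp_add, mul_pow, Real.sq_sqrt (by linarith)]
      rw [← hb] at this
      refine (sub_le_self _ zero_le_one).trans (this.trans (le_of_eq ?_))
      congr 2
      ring
    · have h9 := inv_exceedProb_le_two (σa := σa) (y := fun i => X i ω) (s := s)
        (τ := m - Δ / 2) (by linarith)
      have h10 : ENNReal.ofReal ((exceedProb σa (m - Δ / 2) (fun i => X i ω) s)⁻¹ - 1) ≤ 1 := by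
        rw [← ENNReal.ofReal_one]
        exact ENNReal.ofReal_le_ofReal (by linarith)
      by_cases hωA : ω ∈ A
      · rw [Set.indicator_of_mem hωA]
        exact h10.trans (le_add_left (le_add_right le_rfl))
      by_cases hωB : ω ∈ B
      · rw [Set.indicator_of_mem hωB]
        exact h10.trans (le_add_left (le_add_left (le_add_right le_rfl)))
      refine le_add_right (ENNReal.ofReal_le_ofReal ?_)
      exact inv_exceedProb_sub_one_le (by linarith) hΔ hT h (not_lt.1 hωB) (not_lt.1 hωA)
  calc _ ≤ _ := lintegral_mono hpt
    _ = ENNReal.ofReal (2 / T) + (P A + (P B + ENNReal.ofReal (c * (√(1 - 2 * b))⁻¹))) := by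
        rw [lintegral_add_left measurable_const, lintegral_const,
          lintegral_add_left (measurable_one.indicator hAm),
          lintegral_add_left (measurable_one.indicator hBm), hE, lintegral_indicator_one hAm,
          lintegral_indicator_one hBm, measure_univ, mul_one]
    _ ≤ ENNReal.ofReal (2 / T) + (ENNReal.ofReal (1 / 8 * (1 / 2) ^ s) +
        (ENNReal.ofReal (1 / 4 * (T : ℝ)⁻¹) + ENNReal.ofReal (T : ℝ)⁻¹)) := by
        rw [← ofReal_measureReal (s := A), ← ofReal_measureReal (s := B)]
        gcongr
    _ = _ := by
        rw [← ENNReal.ofReal_add (by positivity) (by positivity),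
          ← ENNReal.ofReal_add (by positivity) (by positivity),
          ← ENNReal.ofReal_add (by positivity) (by positivity)]
        congr 1
        ring

end Sample

/-! ### Pathwise properties of the algorithm. -/

section Deterministic

variable {K : ℕ} (sel : (Fin K → ℝ) → Fin K) (σa : ℝ)

lemma pulls_succ (y : Fin K → ℕ → ℝ) (w : ℕ → Fin K → ℕ → ℝ) (t : ℕ) (k : Fin K) :
    pulls sel σa y w (t + 1) k =
      pulls sel σa y w t k + if arm sel σa y w t = k then 1 else 0 := rfl

lemma pulls_eq_sum (y : Fin K → ℕ → ℝ) (w : ℕ → Fin K → ℕ → ℝ) (t : ℕ) (k : Fin K) :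
    pulls sel σa y w t k = ∑ u ∈ Finset.range t, if arm sel σa y w u = k then 1 else 0 := by
  induction t with
  | zero => rfl
  | succ t ih => rw [Finset.sum_range_succ, ← ih, pulls_succ]

lemma pulls_le (y : Fin K → ℕ → ℝ) (w : ℕ → Fin K → ℕ → ℝ) (t : ℕ) (k : Fin K) :
    pulls sel σa y w t k ≤ t := by
  rw [pulls_eq_sum]
  refine (Finset.sum_le_card_nsmul _ _ 1 fun u _ => ?_).trans (by simp)
  split_ifs <;> simp

lemma pulls_monotone (y : Fin K → ℕ → ℝ) (w : ℕ → Fin K → ℕ → ℝ) (k : Fin K) :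
    Monotone fun t => pulls sel σa y w t k :=
  monotone_nat_of_le_succ fun t => by rw [pulls_succ]; exact Nat.le_add_right _ _

lemma arm_of_lt (y : Fin K → ℕ → ℝ) (w : ℕ → Fin K → ℕ → ℝ) {t : ℕ} (ht : t < K) :
    arm sel σa y w t = ⟨t, ht⟩ := by
  rw [arm, chooseArm, dif_pos ht]

lemma one_le_pulls (y : Fin K → ℕ → ℝ) (w : ℕ → Fin K → ℕ → ℝ) {t : ℕ} (ht : K ≤ t)
    (k : Fin K) : 1 ≤ pulls sel σa y w t k := by
  have h : pulls sel σa y w (k + 1) k ≤ pulls sel σa y w t k :=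
    pulls_monotone sel σa y w k (Nat.succ_le_of_lt (k.2.trans_le ht))
  refine le_trans ?_ h
  rw [pulls_succ, arm_of_lt sel σa y w k.2, if_pos rfl]
  exact Nat.le_add_left _ _

lemma sampleMean_congr {y y' : ℕ → ℝ} {s : ℕ} (h : ∀ i < s, y i = y' i) :
    sampleMean y s = sampleMean y' s := by
  rw [sampleMean, sampleMean, Finset.sum_congr rfl fun i hi => h i (Finset.mem_range.1 hi)]

lemma armIndex_congr {y y' : ℕ → ℝ} {s : ℕ} (h : ∀ i < s, y i = y' i) (w : ℕ → ℝ) :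
    armIndex σa y s w = armIndex σa y' s w := by
  have hr : ∀ i, residual σa y s i = residual σa y' s i := by
    intro i
    unfold residual
    rw [sampleMean_congr h]
    split_ifs with hi
    · rw [h i hi]
    · rfl
    · rfl
  simp only [armIndex, hr, sampleMean_congr h]

lemma chooseArm_congr {y y' : Fin K → ℕ → ℝ} (w : Fin K → ℕ → ℝ) (t : ℕ) {n : Fin K → ℕ}
    (h : ∀ j, ∀ i < n j, y j i = y' j i) :
    chooseArm sel σa y w t n = chooseArm sel σa y' w t n := by
  unfold chooseArm
  simp only [armIndex_congr σa (h _)]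

/-- A reward has no influence before it is received: while arm `k` has at most `l` pulls, only its
rewards numbered below `l` have entered the indices, counting from `0`. -/
lemma pulls_congr_rewards {y y' : Fin K → ℕ → ℝ} (w : ℕ → Fin K → ℕ → ℝ) {t l : ℕ} {k : Fin K}
    (h : ∀ j i, (j = k → i ≠ l) → y j i = y' j i) (hl : pulls sel σa y w t k ≤ l) :
    pulls sel σa y w t = pulls sel σa y' w t ∧ arm sel σa y w t = arm sel σa y' w t := by
  have key : ∀ u, pulls sel σa y w u k ≤ l → pulls sel σa y w u = pulls sel σa y' w u →
      arm sel σa y w u = arm sel σa y' w u := by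
    intro u hu hp
    rw [arm, arm, ← hp]
    refine chooseArm_congr sel σa _ _ fun j i hi => h j i ?_
    rintro rfl
    exact ne_of_lt (hi.trans_le hu)
  induction t with
  | zero => exact ⟨rfl, key 0 hl rfl⟩
  | succ t ih =>
    have h1 := ih ((pulls_monotone sel σa y w k t.le_succ).trans hl)
    have h2 : pulls sel σa y w (t + 1) = pulls sel σa y' w (t + 1) := by
      ext j
      rw [pulls_succ, pulls_succ, h1.1, h1.2]
    exact ⟨h2, key _ hl h2⟩

/-- Each pull raises the count, so the rounds in which `k` is pulled see distinct counts. This turns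
sums over rounds with a random count into sums over fixed sample sizes. -/
lemma sum_pulled_le (y : Fin K → ℕ → ℝ) (w : ℕ → Fin K → ℕ → ℝ) (T : ℕ) (k : Fin K)
    (f : ℕ → ENNReal) :
    ∑ t ∈ Finset.Ico K T, (if arm sel σa y w t = k then f (pulls sel σa y w t k) else 0) ≤
      ∑ s ∈ Finset.Icc 1 (T - 1), f s := by
  classical
  rw [← Finset.sum_filter]
  have hlt : ∀ t t', arm sel σa y w t = k → t < t' →
      pulls sel σa y w t k < pulls sel σa y w t' k := by
    intro t t' ht htt'
    refine lt_of_lt_of_le ?_ (pulls_monotone sel σa y w k (Nat.succ_le_of_lt htt'))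
    change _ < pulls sel σa y w (t + 1) k
    rw [pulls_succ, if_pos ht]
    exact Nat.lt_succ_self _
  have hinj : Set.InjOn (fun t => pulls sel σa y w t k)
      ((Finset.Ico K T).filter fun t => arm sel σa y w t = k) := by
    intro t ht t' ht' he
    simp only [Finset.coe_filter, Set.mem_ofPred_eq] at ht ht'
    rcases lt_trichotomy t t' with h | h | h
    · exact absurd he (hlt t t' ht.2 h).ne
    · exact h
    · exact absurd he (hlt t' t ht'.2 h).ne'
  rw [← Finset.sum_image (f := f) hinj]
  refine Finset.sum_le_sum_of_subset fun s hs => ?_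
  simp only [Finset.mem_image, Finset.mem_filter, Finset.mem_Ico] at hs
  obtain ⟨t, ⟨⟨h1, h2⟩, -⟩, rfl⟩ := hs
  rw [Finset.mem_Icc]
  exact ⟨one_le_pulls sel σa y w h1 k, (pulls_le sel σa y w t k).trans (by omega)⟩

end Deterministic

/-! ### Measurability of the arms and pull counts. -/

section Measurability

variable {K : ℕ} {sel : (Fin K → ℝ) → Fin K}

lemma measurable_chooseArm (hsel : Measurable sel) (σa : ℝ) (t : ℕ) :
    Measurable fun p : (Fin K → ℕ) × ((Fin K → ℕ → ℝ) × (Fin K → ℕ → ℝ)) =>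
      chooseArm sel σa p.2.1 p.2.2 t p.1 := by
  refine measurable_from_prod_countable_right fun n => ?_
  unfold chooseArm
  split_ifs
  · exact measurable_const
  · refine hsel.comp (measurable_pi_lambda _ fun k => ?_)
    have h1 : Measurable fun p : (Fin K → ℕ → ℝ) × (Fin K → ℕ → ℝ) => (p.1 k, p.2 k) := by
      fun_prop
    exact (measurable_armIndex σa (n k)).comp h1

/-- The σ-algebra is left free so that sub-σ-algebras generated by part of the variables can be
used, and only weights of rounds before `t` are required. This is what yields independence from the
weights of round `t`. -/
lemma measurable_pulls (hsel : Measurable sel) (σa : ℝ) {Ω : Type*} {mΩ : MeasurableSpace Ω}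
    {Y : Fin K → ℕ → Ω → ℝ}
    {W : ℕ → Fin K → ℕ → Ω → ℝ} {t : ℕ} (hY : ∀ k l, Measurable (Y k l))
    (hW : ∀ u < t, ∀ k i, Measurable (W u k i)) :
    Measurable fun ω => pulls sel σa (fun k l => Y k l ω) (fun t k i => W t k i ω) t := by
  have hY' : Measurable fun ω => fun k l => Y k l ω := by fun_prop
  induction t with
  | zero => exact measurable_const
  | succ t ih =>
    have ih' := ih fun u hu => hW u (hu.trans t.lt_succ_self)
    have hW' : Measurable fun ω => fun k i => W t k i ω :=
      measurable_pi_lambda _ fun k => measurable_pi_lambda _ fun i => hW t t.lt_succ_self k i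
    have harm := (measurable_chooseArm hsel σa t).comp (ih'.prodMk (hY'.prodMk hW'))
    refine measurable_pi_lambda _ fun k => ?_
    refine ((measurable_pi_apply k).comp ih').add ?_
    exact Measurable.ite (harm (measurableSet_singleton k)) measurable_const measurable_const

lemma measurable_arm (hsel : Measurable sel) (σa : ℝ) {Ω : Type*} {mΩ : MeasurableSpace Ω}
    {Y : Fin K → ℕ → Ω → ℝ}
    {W : ℕ → Fin K → ℕ → Ω → ℝ} {t : ℕ} (hY : ∀ k l, Measurable (Y k l))
    (hW : ∀ u ≤ t, ∀ k i, Measurable (W u k i)) :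
    Measurable fun ω => arm sel σa (fun k l => Y k l ω) (fun t k i => W t k i ω) t := by
  have hY' : Measurable fun ω => fun k l => Y k l ω := by fun_prop
  have hW' : Measurable fun ω => fun k i => W t k i ω :=
    measurable_pi_lambda _ fun k => measurable_pi_lambda _ fun i => hW t le_rfl k i
  exact (measurable_chooseArm hsel σa t).comp
    ((measurable_pulls hsel σa hY fun u hu => hW u hu.le).prodMk (hY'.prodMk hW'))

end Measurability

/-! ### Splitting a reward according to the arm and the pull number. -/

section PullEvent

variable {K : ℕ} {Ω : Type*} {sel : (Fin K → ℝ) → Fin K}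

/-- The event that round `t` is the pull number `l` of arm `k`. -/
def pullEvent (sel : (Fin K → ℝ) → Fin K) (σa : ℝ) (Y : Fin K → ℕ → Ω → ℝ)
    (W : ℕ → Fin K → ℕ → Ω → ℝ) (t : ℕ) (k : Fin K) (l : ℕ) : Set Ω :=
  {ω | arm sel σa (fun k l => Y k l ω) (fun t k i => W t k i ω) t = k ∧
    pulls sel σa (fun k l => Y k l ω) (fun t k i => W t k i ω) t k = l}

lemma measurableSet_pullEvent {mΩ : MeasurableSpace Ω}
    {Y : Fin K → ℕ → Ω → ℝ} {W : ℕ → Fin K → ℕ → Ω → ℝ} (hsel : Measurable sel) (σa : ℝ)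
    (hY : ∀ k l, Measurable (Y k l)) (hW : ∀ t k i, Measurable (W t k i))
    (t : ℕ) (k : Fin K) (l : ℕ) : MeasurableSet (pullEvent sel σa Y W t k l) :=
  (measurable_arm hsel σa hY (fun u _ => hW u) (measurableSet_singleton k)).inter
    (((measurable_pi_apply k).comp (measurable_pulls hsel σa hY fun u _ => hW u))
      (measurableSet_singleton l))

lemma reward_eq_sum (sel : (Fin K → ℝ) → Fin K) (σa : ℝ) (Y : Fin K → ℕ → Ω → ℝ)
    (W : ℕ → Fin K → ℕ → Ω → ℝ) (t : ℕ) (ω : Ω) :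
    reward sel σa (fun k l => Y k l ω) (fun t k i => W t k i ω) t =
      ∑ k, ∑ l ∈ Finset.range (t + 1), (pullEvent sel σa Y W t k l).indicator (Y k l) ω := by
  classical
  set I := arm sel σa (fun k l => Y k l ω) (fun t k i => W t k i ω) t with hI
  rw [Finset.sum_eq_single I, Finset.sum_eq_single
    (pulls sel σa (fun k l => Y k l ω) (fun t k i => W t k i ω) t I)]
  · rw [Set.indicator_of_mem (show ω ∈ pullEvent sel σa Y W t I _ from ⟨rfl, rfl⟩)]
    rfl
  · intro l _ hl
    exact Set.indicator_of_notMem (fun hc => hl hc.2.symm) _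
  · intro hc
    exact absurd (Finset.mem_range.2 (Nat.lt_succ_of_le (pulls_le sel σa _ _ t I))) hc
  · intro k _ hk
    refine Finset.sum_eq_zero fun l _ => Set.indicator_of_notMem (fun hc => hk hc.1.symm) _
  · intro hc
    exact absurd (Finset.mem_univ _) hc

end PullEvent

/-! ### Independence of disjoint blocks of variables. -/

section Independence

variable {ι Ω : Type*} {mΩ : MeasurableSpace Ω} {P : Measure Ω}

/-- The σ-algebra generated by the variables with index in `S`. -/
abbrev sigmaOn (Z : ι → Ω → ℝ) (S : Set ι) : MeasurableSpace Ω :=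
  ⨆ i ∈ S, MeasurableSpace.comap (Z i) inferInstance

lemma measurable_sigmaOn (Z : ι → Ω → ℝ) {S : Set ι} {i : ι} (hi : i ∈ S) :
    Measurable[sigmaOn Z S] (Z i) :=
  (comap_measurable (Z i)).mono
    (le_iSup₂_of_le (f := fun i (_ : i ∈ S) => MeasurableSpace.comap (Z i) inferInstance)
      i hi le_rfl) le_rfl

lemma indep_sigmaOn {Z : ι → Ω → ℝ} (hZ : ∀ i, Measurable (Z i)) (hind : iIndepFun Z P)
    {S S' : Set ι} (h : Disjoint S S') : Indep (sigmaOn Z S) (sigmaOn Z S') P :=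
  indep_iSup_of_disjoint (fun i => (hZ i).comap_le) hind.iIndep h

lemma indepFun_of_sigmaOn {Z : ι → Ω → ℝ} (hZ : ∀ i, Measurable (Z i)) (hind : iIndepFun Z P)
    {S S' : Set ι} (h : Disjoint S S') {α β : Type*} [MeasurableSpace α] [MeasurableSpace β]
    {X : Ω → α} {V : Ω → β} (hX : Measurable[sigmaOn Z S] X) (hV : Measurable[sigmaOn Z S'] V) :
    IndepFun X V P :=
  (IndepFun_iff_Indep X V P).2
    (indep_of_indep_of_le (indep_sigmaOn hZ hind h) hX.comap_le hV.comap_le)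

lemma lintegral_indepFun_eq [IsProbabilityMeasure P] {α β : Type*} [MeasurableSpace α]
    [MeasurableSpace β] {X : Ω → α} {V : Ω → β} (hX : Measurable X) (hV : Measurable V)
    (h : IndepFun X V P) {g : α × β → ENNReal} (hg : Measurable g) :
    ∫⁻ ω, g (X ω, V ω) ∂P = ∫⁻ ω, ∫⁻ ω', g (X ω, V ω') ∂P ∂P := by
  have h1 := (indepFun_iff_map_prod_eq_prod_map_map hX.aemeasurable hV.aemeasurable).1 h
  have : IsProbabilityMeasure (P.map V) := Measure.isProbabilityMeasure_map hV.aemeasurable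
  rw [← lintegral_map hg (hX.prodMk hV), h1, lintegral_prod _ hg.aemeasurable,
    lintegral_map hg.lintegral_prod_right' hX]
  refine lintegral_congr fun ω => ?_
  exact lintegral_map (hg.comp measurable_prodMk_left) hV

end Independence

/-! ### Integrability and the regret decomposition. -/

namespace IsGaussianModel

variable {K : ℕ} {Ω : Type*} [MeasurableSpace Ω] {P : Measure Ω}
  {μ : Fin K → ℝ} {Y : Fin K → ℕ → Ω → ℝ} {W : ℕ → Fin K → ℕ → Ω → ℝ}
  {sel : (Fin K → ℝ) → Fin K}

/-- All the driving variables as one family. -/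
abbrev family (Y : Fin K → ℕ → Ω → ℝ) (W : ℕ → Fin K → ℕ → Ω → ℝ) :
    (Fin K × ℕ) ⊕ (ℕ × Fin K × ℕ) → Ω → ℝ :=
  Sum.elim (fun p => Y p.1 p.2) (fun q => W q.1 q.2.1 q.2.2)

lemma measurable_family (h : IsGaussianModel P μ Y W) (i : (Fin K × ℕ) ⊕ (ℕ × Fin K × ℕ)) :
    Measurable (family Y W i) := by
  rcases i with p | q
  · exact h.measurable_reward _ _
  · exact h.measurable_weight _ _ _

lemma iIndepFun_reward (h : IsGaussianModel P μ Y W) (k : Fin K) : iIndepFun (Y k) P :=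
  h.indep.precomp (g := fun l => Sum.inl (k, l)) fun a b hab => by simpa using hab

lemma iIndepFun_weight (h : IsGaussianModel P μ Y W) (t : ℕ) (k : Fin K) :
    iIndepFun (W t k) P :=
  h.indep.precomp (g := fun i => Sum.inr (t, k, i)) fun a b hab => by simpa using hab

lemma measurable_arm (h : IsGaussianModel P μ Y W) (hsel : Measurable sel) (σa : ℝ) (t : ℕ) :
    Measurable fun ω => arm sel σa (fun k l => Y k l ω) (fun t k i => W t k i ω) t :=
  ReBoot.measurable_arm hsel σa h.measurable_reward fun u _ => h.measurable_weight u

lemma measurable_pulls (h : IsGaussianModel P μ Y W) (hsel : Measurable sel) (σa : ℝ) (t : ℕ) :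
    Measurable fun ω => pulls sel σa (fun k l => Y k l ω) (fun t k i => W t k i ω) t :=
  ReBoot.measurable_pulls hsel σa h.measurable_reward fun u _ => h.measurable_weight u

lemma integrable_reward (h : IsGaussianModel P μ Y W) (k : Fin K) (l : ℕ) :
    Integrable (Y k l) P := by
  have h1 : Integrable id (gaussianReal (μ k) 1) :=
    (memLp_id_gaussianReal 1).integrable le_rfl
  rw [← h.law_reward k l] at h1
  exact h1.comp_measurable (h.measurable_reward k l)

lemma integral_reward (h : IsGaussianModel P μ Y W) (k : Fin K) (l : ℕ) :
    ∫ ω, Y k l ω ∂P = μ k := by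
  have h1 : ∫ x, x ∂(gaussianReal (μ k) 1) = μ k := integral_id_gaussianReal
  rwa [← h.law_reward k l, integral_map (h.measurable_reward k l).aemeasurable (by fun_prop)]
    at h1

/-- The decision to make pull `l` of arm `k` in round `t` is independent of the reward that this
pull returns. -/
lemma integral_indicator_pullEvent (h : IsGaussianModel P μ Y W) (hsel : Measurable sel)
    (σa : ℝ) (t : ℕ) (k : Fin K) (l : ℕ) :
    ∫ ω, (pullEvent sel σa Y W t k l).indicator (Y k l) ω ∂P =
      μ k * P.real (pullEvent sel σa Y W t k l) := by
  classical
  set S : Set ((Fin K × ℕ) ⊕ (ℕ × Fin K × ℕ)) := {Sum.inl (k, l)} with hS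
  -- Zeroing the reward in question leaves the event unchanged, which shows that the event is
  -- measurable for all the other variables.
  set Y' : Fin K → ℕ → Ω → ℝ := fun j i => if j = k ∧ i = l then 0 else Y j i with hY'
  have hEE' : pullEvent sel σa Y W t k l = pullEvent sel σa Y' W t k l := by
    ext ω
    have hag : ∀ j i, (j = k → i ≠ l) → Y j i ω = Y' j i ω := by
      intro j i hji
      rw [hY']
      simp only
      rw [if_neg fun hc => hji hc.1 hc.2]
    simp only [pullEvent, Set.mem_ofPred_eq]
    constructor
    · rintro ⟨h1, h2⟩
      obtain ⟨h3, h4⟩ := pulls_congr_rewards sel σa (y := fun k l => Y k l ω)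
        (y' := fun k l => Y' k l ω) (fun t k i => W t k i ω) hag h2.le
      rw [← h4, ← h3]
      exact ⟨h1, h2⟩
    · rintro ⟨h1, h2⟩
      obtain ⟨h3, h4⟩ := pulls_congr_rewards sel σa (y := fun k l => Y' k l ω)
        (y' := fun k l => Y k l ω) (fun t k i => W t k i ω) (fun j i hji => (hag j i hji).symm)
        h2.le
      rw [← h4, ← h3]
      exact ⟨h1, h2⟩
  have hE' : MeasurableSet[sigmaOn (family Y W) Sᶜ] (pullEvent sel σa Y' W t k l) := by
    refine measurableSet_pullEvent hsel σa ?_ ?_ t k l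
    · intro j i
      simp only [hY']
      split_ifs with hc
      · exact measurable_const
      · exact measurable_sigmaOn (family Y W) (i := Sum.inl (j, i)) (by simpa [hS] using hc)
    · intro u j i
      exact measurable_sigmaOn (family Y W) (i := Sum.inr (u, j, i)) (by simp [hS])
  rw [← hEE'] at hE'
  have hE : MeasurableSet (pullEvent sel σa Y W t k l) :=
    measurableSet_pullEvent hsel σa h.measurable_reward h.measurable_weight t k l
  have hind : IndepFun (Y k l) ((pullEvent sel σa Y W t k l).indicator fun _ => (1 : ℝ)) P := by
    refine indepFun_of_sigmaOn h.measurable_family h.indep (disjoint_compl_right (a := S))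
      (measurable_sigmaOn (family Y W) (i := Sum.inl (k, l)) (by simp [hS])) ?_
    exact (@measurable_const _ _ _ (sigmaOn (family Y W) Sᶜ) (1 : ℝ)).indicator hE'
  have hprod := hind.integral_fun_mul_eq_mul_integral
    (h.measurable_reward k l).aestronglyMeasurable
    ((measurable_const.indicator hE).aestronglyMeasurable)
  rw [integral_indicator_const _ hE, h.integral_reward, smul_eq_mul, mul_one] at hprod
  rw [← hprod]
  refine integral_congr_ae (Filter.Eventually.of_forall fun ω => ?_)
  by_cases hω : ω ∈ pullEvent sel σa Y W t k l <;> simp [hω]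

lemma integrable_indicator_pullEvent (h : IsGaussianModel P μ Y W) (hsel : Measurable sel)
    (σa : ℝ) (t : ℕ) (k : Fin K) (l : ℕ) :
    Integrable ((pullEvent sel σa Y W t k l).indicator (Y k l)) P :=
  (h.integrable_reward k l).indicator
    (measurableSet_pullEvent hsel σa h.measurable_reward h.measurable_weight t k l)

lemma integrable_armReward (h : IsGaussianModel P μ Y W) (hsel : Measurable sel)
    (σa : ℝ) (t : ℕ) :
    Integrable (fun ω => reward sel σa (fun k l => Y k l ω) (fun t k i => W t k i ω) t) P := by
  simp_rw [reward_eq_sum]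
  exact integrable_finsetSum _ fun k _ => integrable_finsetSum _ fun l _ =>
    h.integrable_indicator_pullEvent hsel σa t k l

lemma integrable_totalReward (h : IsGaussianModel P μ Y W) (hsel : Measurable sel)
    (σa : ℝ) (T : ℕ) :
    Integrable (fun ω =>
      totalReward sel σa (fun k l => Y k l ω) (fun t k i => W t k i ω) T) P :=
  integrable_finsetSum _ fun t _ => h.integrable_armReward hsel σa t

variable [IsProbabilityMeasure P]

lemma measureReal_arm_eq_sum (h : IsGaussianModel P μ Y W) (hsel : Measurable sel) (σa : ℝ)
    (t : ℕ) (k : Fin K) :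
    P.real {ω | arm sel σa (fun k l => Y k l ω) (fun t k i => W t k i ω) t = k} =
      ∑ l ∈ Finset.range (t + 1), P.real (pullEvent sel σa Y W t k l) := by
  rw [← measureReal_biUnion_finset]
  · congr 1
    ext ω
    simp only [pullEvent, Set.mem_ofPred_eq, Set.mem_iUnion, Finset.mem_range, exists_prop]
    constructor
    · intro hω
      exact ⟨_, Nat.lt_succ_of_le (pulls_le sel σa _ _ t k), hω, rfl⟩
    · rintro ⟨l, -, hω, -⟩
      exact hω
  · intro l _ l' _ hne
    refine Set.disjoint_left.2 fun ω hω hω' => hne ?_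
    rw [← hω.2, ← hω'.2]
  · intro l _
    exact measurableSet_pullEvent hsel σa h.measurable_reward h.measurable_weight t k l

lemma integral_armReward (h : IsGaussianModel P μ Y W) (hsel : Measurable sel)
    (σa : ℝ) (t : ℕ) :
    ∫ ω, reward sel σa (fun k l => Y k l ω) (fun t k i => W t k i ω) t ∂P =
      ∑ k, μ k * P.real {ω | arm sel σa (fun k l => Y k l ω) (fun t k i => W t k i ω) t = k} := by
  simp_rw [reward_eq_sum]
  rw [integral_finsetSum _ fun k _ => integrable_finsetSum _ fun l _ =>
    h.integrable_indicator_pullEvent hsel σa t k l]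
  refine Finset.sum_congr rfl fun k _ => ?_
  rw [integral_finsetSum _ fun l _ => h.integrable_indicator_pullEvent hsel σa t k l,
    h.measureReal_arm_eq_sum hsel, Finset.mul_sum]
  exact Finset.sum_congr rfl fun l _ => h.integral_indicator_pullEvent hsel σa t k l

lemma sum_measureReal_arm (h : IsGaussianModel P μ Y W) (hsel : Measurable sel)
    (σa : ℝ) (t : ℕ) :
    ∑ k, P.real {ω | arm sel σa (fun k l => Y k l ω) (fun t k i => W t k i ω) t = k} = 1 := by
  rw [← measureReal_biUnion_finset]
  · rw [← probReal_univ (μ := P)]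
    congr 1
    ext ω
    simp
  · intro k _ k' _ hne
    exact Set.disjoint_left.2 fun ω hω hω' => hne (hω.symm.trans hω')
  · intro k _
    exact h.measurable_arm hsel σa t (measurableSet_singleton k)

lemma regret_eq_sum [NeZero K] (h : IsGaussianModel P μ Y W) (hsel : Measurable sel)
    (σa : ℝ) (T : ℕ) :
    regret P μ sel σa Y W T = ∑ k, gap μ k * ∑ t ∈ Finset.range T,
      P.real {ω | arm sel σa (fun k l => Y k l ω) (fun t k i => W t k i ω) t = k} := by
  simp_rw [regret, totalReward]
  rw [integral_finsetSum _ fun t _ => h.integrable_armReward hsel σa t]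
  simp_rw [Finset.mul_sum]
  rw [Finset.sum_comm]
  have : (T : ℝ) * μ 0 = ∑ t ∈ Finset.range T, μ 0 := by simp
  rw [this, ← Finset.sum_sub_distrib]
  refine Finset.sum_congr rfl fun t _ => ?_
  rw [h.integral_armReward hsel]
  simp_rw [gap, sub_mul]
  rw [Finset.sum_sub_distrib, ← Finset.mul_sum, h.sum_measureReal_arm hsel, mul_one]

end IsGaussianModel

lemma measurable_apply_nat {γ δ : Type*} [MeasurableSpace γ] [MeasurableSpace δ] {f : ℕ → γ → δ}
    (hf : ∀ s, Measurable (f s)) {N : γ → ℕ} (hN : Measurable N) :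
    Measurable fun c => f (N c) c :=
  (measurable_from_prod_countable_right (f := fun p : ℕ × γ => f p.1 p.2) hf).comp
    (hN.prodMk measurable_id)

/-! ### Conditioning on the rewards and the past weights. -/

namespace IsGaussianModel

variable {K : ℕ} {Ω : Type*} [MeasurableSpace Ω] {P : Measure Ω}
  {μ : Fin K → ℝ} {Y : Fin K → ℕ → Ω → ℝ} {W : ℕ → Fin K → ℕ → Ω → ℝ}
  {sel : (Fin K → ℝ) → Fin K} {σa : ℝ}

lemma indepFun_past_weight (h : IsGaussianModel P μ Y W) (hsel : Measurable sel) (t : ℕ) :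
    IndepFun (fun ω => ((fun k l => Y k l ω : Fin K → ℕ → ℝ),
        pulls sel σa (fun k l => Y k l ω) (fun t k i => W t k i ω) t))
      (fun ω => (fun k i => W t k i ω : Fin K → ℕ → ℝ)) P := by
  set S : Set ((Fin K × ℕ) ⊕ (ℕ × Fin K × ℕ)) :=
    {i | Sum.elim (fun _ => True) (fun q => q.1 < t) i} with hS
  have hY : ∀ k l, Measurable[sigmaOn (family Y W) S] (Y k l) := fun k l =>
    measurable_sigmaOn (family Y W) (i := Sum.inl (k, l)) (by simp [hS])
  have hW : ∀ u < t, ∀ k i, Measurable[sigmaOn (family Y W) S] (W u k i) := fun u hu k i =>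
    measurable_sigmaOn (family Y W) (i := Sum.inr (u, k, i)) (by simpa [hS] using hu)
  have hV : ∀ k i, Measurable[sigmaOn (family Y W) Sᶜ] (W t k i) := fun k i =>
    measurable_sigmaOn (family Y W) (i := Sum.inr (t, k, i)) (by simp [hS])
  refine indepFun_of_sigmaOn h.measurable_family h.indep (disjoint_compl_right (a := S)) ?_ ?_
  · exact Measurable.prodMk (@measurable_pi_lambda _ _ _ (sigmaOn (family Y W) S) _ _ fun k =>
      @measurable_pi_lambda _ _ _ (sigmaOn (family Y W) S) _ _ (hY k))
      (ReBoot.measurable_pulls hsel σa hY hW)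
  · exact @measurable_pi_lambda _ _ _ (sigmaOn (family Y W) Sᶜ) _ _ fun k =>
      @measurable_pi_lambda _ _ _ (sigmaOn (family Y W) Sᶜ) _ _ (hV k)

lemma sum_lintegral_pulled_le (h : IsGaussianModel P μ Y W) (hsel : Measurable sel) (T : ℕ)
    (k : Fin K) {f : ℕ → Ω → ENNReal} (hf : ∀ s, Measurable (f s)) :
    ∑ t ∈ Finset.Ico K T, ∫⁻ ω,
        (if arm sel σa (fun k l => Y k l ω) (fun t k i => W t k i ω) t = k then
          f (pulls sel σa (fun k l => Y k l ω) (fun t k i => W t k i ω) t k) ω else 0) ∂P ≤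
      ∑ s ∈ Finset.Icc 1 (T - 1), ∫⁻ ω, f s ω ∂P := by
  have hm : ∀ t, Measurable fun ω =>
      (if arm sel σa (fun k l => Y k l ω) (fun t k i => W t k i ω) t = k then
        f (pulls sel σa (fun k l => Y k l ω) (fun t k i => W t k i ω) t k) ω else 0) := by
    intro t
    have hN : Measurable fun ω =>
        pulls sel σa (fun k l => Y k l ω) (fun t k i => W t k i ω) t k :=
      (measurable_pi_apply k).comp (h.measurable_pulls hsel σa t)
    exact Measurable.ite (h.measurable_arm hsel σa t (measurableSet_singleton k))
      (measurable_apply_nat hf hN) measurable_const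
  rw [← lintegral_finsetSum _ fun t _ => hm t, ← lintegral_finsetSum _ fun s _ => hf s]
  exact lintegral_mono fun ω => sum_pulled_le sel σa _ _ T k fun s => f s ω

variable [IsProbabilityMeasure P]

lemma measure_lt_armIndex (h : IsGaussianModel P μ Y W) (hσ : 0 < σa) (t : ℕ) (k : Fin K)
    (τ : ℝ) (y : ℕ → ℝ) (s : ℕ) :
    P {ω | τ < armIndex σa y s (fun i => W t k i ω)} =
      ENNReal.ofReal (exceedProb σa τ y s) := by
  rw [← measureReal_lt_armIndex (h.measurable_weight t k) (h.law_weight t k)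
    (h.iIndepFun_weight t k) hσ, ofReal_measureReal]

/-- Let `E` say that arm `0` exceeds `τ`, and `B` that no other arm does. The left event forces `Eᶜ
∩ B`, while `E ∩ B` forces a pull of arm `0`. Rewards and counts being frozen, `E` and `B` are
independent, so the two intersections differ by the factor `P Eᶜ / P E`, which is `1 / Q - 1`. -/
lemma measure_chooseArm_le [NeZero K] (h : IsGaussianModel P μ Y W) (hσ : 0 < σa)
    (hsel : IsArgmax sel) {t : ℕ} (ht : K ≤ t) (τ : ℝ) (y : Fin K → ℕ → ℝ) (n : Fin K → ℕ)
    (k : Fin K) :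
    P {ω | chooseArm sel σa y (fun k i => W t k i ω) t n = k ∧
        armIndex σa (y k) (n k) (fun i => W t k i ω) ≤ τ} ≤
      ENNReal.ofReal ((exceedProb σa τ (y 0) (n 0))⁻¹ - 1) *
        P {ω | chooseArm sel σa y (fun k i => W t k i ω) t n = 0} := by
  have hchoose : ∀ ω, chooseArm sel σa y (fun k i => W t k i ω) t n =
      sel fun j => armIndex σa (y j) (n j) (fun i => W t j i ω) := by
    intro ω
    rw [chooseArm, dif_neg (not_lt.2 ht)]
  simp_rw [hchoose]
  set S : Set ((Fin K × ℕ) ⊕ (ℕ × Fin K × ℕ)) :=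
    {i | Sum.elim (fun _ => False) (fun q => q.2.1 = 0) i} with hS
  set E : Set Ω := {ω | τ < armIndex σa (y 0) (n 0) (fun i => W t 0 i ω)} with hE
  set B : Set Ω := {ω | ∀ j, j ≠ 0 → armIndex σa (y j) (n j) (fun i => W t j i ω) ≤ τ} with hB
  have hidx : ∀ {m : MeasurableSpace Ω} (j : Fin K), (∀ i, Measurable (W t j i)) →
      Measurable fun ω => armIndex σa (y j) (n j) (fun i => W t j i ω) := by
    intro m j hj
    exact (measurable_armIndex σa (n j)).comp (measurable_const.prodMk (measurable_pi_lambda _ hj))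
  have hEm : MeasurableSet[sigmaOn (family Y W) S] E :=
    (hidx 0 fun i => measurable_sigmaOn (family Y W) (i := Sum.inr (t, 0, i)) (by simp [hS]))
      measurableSet_Ioi
  have hBm : MeasurableSet[sigmaOn (family Y W) Sᶜ] B := by
    simp only [hB, Set.ofPred_forall]
    refine MeasurableSet.iInter fun j => MeasurableSet.iInter fun hj => ?_
    exact (hidx j fun i => measurable_sigmaOn (family Y W) (i := Sum.inr (t, j, i))
      (by simpa [hS] using hj)) measurableSet_Iic
  have hind := (Indep_iff _ _ _).1
    (indep_sigmaOn h.measurable_family h.indep (disjoint_compl_right (a := S)))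
  have h1 := hind E B hEm hBm
  have h2 := hind Eᶜ B hEm.compl hBm
  have hQ := h.measure_lt_armIndex hσ t 0 τ (y 0) (n 0)
  rw [← hE] at hQ
  have hpos := exceedProb_pos σa τ (y 0) (n 0)
  have hEm' : MeasurableSet E := hidx 0 (h.measurable_weight t 0) measurableSet_Ioi
  have hQc : P Eᶜ = ENNReal.ofReal ((exceedProb σa τ (y 0) (n 0))⁻¹ - 1) * P E := by
    rw [prob_compl_eq_one_sub hEm', hQ, ← ENNReal.ofReal_one,
      ← ENNReal.ofReal_sub _ hpos.le, ← ENNReal.ofReal_mul' hpos.le, sub_mul,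
      inv_mul_cancel₀ hpos.ne', one_mul]
  calc P {ω | (sel fun j => armIndex σa (y j) (n j) (fun i => W t j i ω)) = k ∧
        armIndex σa (y k) (n k) (fun i => W t k i ω) ≤ τ} ≤ P (Eᶜ ∩ B) := by
        refine measure_mono ?_
        rintro ω ⟨hω, hω'⟩
        have hall : ∀ j, armIndex σa (y j) (n j) (fun i => W t j i ω) ≤ τ := by
          intro j
          have := hsel (fun j => armIndex σa (y j) (n j) (fun i => W t j i ω)) j
          rw [hω] at this
          exact this.trans hω'
        exact ⟨not_lt.2 (hall 0), fun j _ => hall j⟩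
    _ = ENNReal.ofReal ((exceedProb σa τ (y 0) (n 0))⁻¹ - 1) * P (E ∩ B) := by
        rw [h1, h2, hQc, mul_assoc]
    _ ≤ _ := by
        gcongr
        rintro ω ⟨hω, hω'⟩
        by_contra hc
        have := hsel (fun j => armIndex σa (y j) (n j) (fun i => W t j i ω)) 0
        exact absurd (this.trans (hω' _ hc)) (not_le.2 hω)

/-- Fubini in place of a conditional expectation: `ω` carries the rewards and pull counts, `ω'` the
fresh weights of round `t`. -/
lemma lintegral_past_weight (h : IsGaussianModel P μ Y W) (hsel : Measurable sel) (t : ℕ)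
    {g : ((Fin K → ℕ → ℝ) × (Fin K → ℕ)) × (Fin K → ℕ → ℝ) → ENNReal} (hg : Measurable g) :
    ∫⁻ ω, g ((fun k l => Y k l ω,
        pulls sel σa (fun k l => Y k l ω) (fun t k i => W t k i ω) t), fun k i => W t k i ω) ∂P =
      ∫⁻ ω, ∫⁻ ω', g ((fun k l => Y k l ω,
        pulls sel σa (fun k l => Y k l ω) (fun t k i => W t k i ω) t),
          fun k i => W t k i ω') ∂P ∂P := by
  have hY := h.measurable_reward
  have hW := h.measurable_weight t
  have hp := h.measurable_pulls hsel σa t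
  exact lintegral_indepFun_eq (X := fun ω => ((fun k l => Y k l ω : Fin K → ℕ → ℝ),
      pulls sel σa (fun k l => Y k l ω) (fun t k i => W t k i ω) t))
    (V := fun ω => (fun k i => W t k i ω : Fin K → ℕ → ℝ))
    (Measurable.prodMk (by fun_prop) hp) (by fun_prop) (h.indepFun_past_weight hsel t) hg

lemma measurable_exceedProb_past (τ : ℝ) (k : Fin K) :
    Measurable fun p : ((Fin K → ℕ → ℝ) × (Fin K → ℕ)) × (Fin K → ℕ → ℝ) =>
      exceedProb σa τ (p.1.1 k) (p.1.2 k) :=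
  measurable_apply_nat
    (f := fun s (p : ((Fin K → ℕ → ℝ) × (Fin K → ℕ)) × (Fin K → ℕ → ℝ)) =>
      exceedProb σa τ (p.1.1 k) s)
    (fun s => (measurable_exceedProb σa τ s).comp (by fun_prop)) (by fun_prop)

lemma measurable_armIndex_past (k : Fin K) :
    Measurable fun p : ((Fin K → ℕ → ℝ) × (Fin K → ℕ)) × (Fin K → ℕ → ℝ) =>
      armIndex σa (p.1.1 k) (p.1.2 k) (p.2 k) :=
  measurable_apply_nat
    (f := fun s (p : ((Fin K → ℕ → ℝ) × (Fin K → ℕ)) × (Fin K → ℕ → ℝ)) =>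
      armIndex σa (p.1.1 k) s (p.2 k))
    (fun s => (measurable_armIndex σa s).comp
      (Measurable.prodMk (f := fun p : ((Fin K → ℕ → ℝ) × (Fin K → ℕ)) × (Fin K → ℕ → ℝ) =>
        p.1.1 k) (by fun_prop) (by fun_prop))) (by fun_prop)

lemma measurable_chooseArm_past (hsel : Measurable sel) (t : ℕ) :
    Measurable fun p : ((Fin K → ℕ → ℝ) × (Fin K → ℕ)) × (Fin K → ℕ → ℝ) =>
      chooseArm sel σa p.1.1 p.2 t p.1.2 :=
  (measurable_chooseArm hsel σa t).comp
    ((measurable_snd.comp measurable_fst).prodMk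
      ((measurable_fst.comp measurable_fst).prodMk measurable_snd))

lemma measure_exceedProb_le_and_lt_armIndex (h : IsGaussianModel P μ Y W) (hσ : 0 < σa)
    (hsel : Measurable sel) (t : ℕ) (τ c : ℝ) (k : Fin K) :
    P {ω | exceedProb σa τ (fun l => Y k l ω)
        (pulls sel σa (fun k l => Y k l ω) (fun t k i => W t k i ω) t k) ≤ c ∧
      τ < armIndex σa (fun l => Y k l ω)
        (pulls sel σa (fun k l => Y k l ω) (fun t k i => W t k i ω) t k)
        (fun i => W t k i ω)} ≤ ENNReal.ofReal c := by
  set D : Set (((Fin K → ℕ → ℝ) × (Fin K → ℕ)) × (Fin K → ℕ → ℝ)) :=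
    {p | exceedProb σa τ (p.1.1 k) (p.1.2 k) ≤ c ∧
      τ < armIndex σa (p.1.1 k) (p.1.2 k) (p.2 k)} with hD
  have hDm : MeasurableSet D :=
    (measurableSet_le (measurable_exceedProb_past τ k) measurable_const).inter
      (measurableSet_lt measurable_const (measurable_armIndex_past k))
  have hY := h.measurable_reward
  have hW := h.measurable_weight
  have hp := h.measurable_pulls hsel σa t
  have hmap : Measurable fun ω => (((fun k l => Y k l ω : Fin K → ℕ → ℝ),
      pulls sel σa (fun k l => Y k l ω) (fun t k i => W t k i ω) t),
        (fun k i => W t k i ω : Fin K → ℕ → ℝ)) :=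
    (Measurable.prodMk (by fun_prop) hp).prodMk (by fun_prop)
  have h1 := h.lintegral_past_weight (σa := σa) hsel t (measurable_one.indicator hDm)
  calc _ = _ := (lintegral_indicator_one (hmap hDm)).symm
    _ = _ := h1
    _ ≤ ∫⁻ _, ENNReal.ofReal c ∂P := by
        refine lintegral_mono fun ω => ?_
        have hm2 : Measurable fun ω' => (((fun k l => Y k l ω : Fin K → ℕ → ℝ),
            pulls sel σa (fun k l => Y k l ω) (fun t k i => W t k i ω) t),
              (fun k i => W t k i ω' : Fin K → ℕ → ℝ)) :=
          measurable_const.prodMk (by fun_prop)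
        refine (lintegral_indicator_one (hm2 hDm)).trans_le ?_
        by_cases hc : exceedProb σa τ (fun l => Y k l ω)
            (pulls sel σa (fun k l => Y k l ω) (fun t k i => W t k i ω) t k) ≤ c
        · refine (measure_mono ?_).trans ((h.measure_lt_armIndex hσ t k τ _ _).trans_le
            (ENNReal.ofReal_le_ofReal hc))
          exact fun ω' hω' => hω'.2
        · refine (measure_mono (t := ∅) ?_).trans (by simp)
          exact fun ω' hω' => hc hω'.1
    _ = _ := by simp

/-- The frozen comparison `measure_chooseArm_le` is integrated over the past. Undoing the freezing
on the right restores the indicator that arm `0` is pulled, which is what allows summation over the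
pulls of arm `0`. -/
lemma measure_arm_eq_and_armIndex_le [NeZero K] (h : IsGaussianModel P μ Y W) (hσ : 0 < σa)
    (hsel : IsArgmax sel) (hsel_meas : Measurable sel) {t : ℕ} (ht : K ≤ t) (τ : ℝ)
    (k : Fin K) :
    P {ω | arm sel σa (fun k l => Y k l ω) (fun t k i => W t k i ω) t = k ∧
      armIndex σa (fun l => Y k l ω)
        (pulls sel σa (fun k l => Y k l ω) (fun t k i => W t k i ω) t k)
        (fun i => W t k i ω) ≤ τ} ≤
      ∫⁻ ω, (if arm sel σa (fun k l => Y k l ω) (fun t k i => W t k i ω) t = 0 then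
        ENNReal.ofReal ((exceedProb σa τ (fun l => Y 0 l ω)
          (pulls sel σa (fun k l => Y k l ω) (fun t k i => W t k i ω) t 0))⁻¹ - 1) else 0) ∂P := by
  set D : Set (((Fin K → ℕ → ℝ) × (Fin K → ℕ)) × (Fin K → ℕ → ℝ)) :=
    {p | chooseArm sel σa p.1.1 p.2 t p.1.2 = k ∧
      armIndex σa (p.1.1 k) (p.1.2 k) (p.2 k) ≤ τ} with hD
  set g : ((Fin K → ℕ → ℝ) × (Fin K → ℕ)) × (Fin K → ℕ → ℝ) → ENNReal := fun p =>
    if chooseArm sel σa p.1.1 p.2 t p.1.2 = 0 then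
      ENNReal.ofReal ((exceedProb σa τ (p.1.1 0) (p.1.2 0))⁻¹ - 1) else 0 with hg
  have hch := measurable_chooseArm_past (σa := σa) hsel_meas t
  have hDm : MeasurableSet D :=
    (hch (measurableSet_singleton k)).inter
      (measurableSet_le (measurable_armIndex_past k) measurable_const)
  have hgm : Measurable g :=
    Measurable.ite (hch (measurableSet_singleton 0))
      (((measurable_exceedProb_past τ 0).inv.sub_const 1).ennreal_ofReal) measurable_const
  have hY := h.measurable_reward
  have hW := h.measurable_weight
  have hp := h.measurable_pulls hsel_meas σa t
  have hmap : Measurable fun ω => (((fun k l => Y k l ω : Fin K → ℕ → ℝ),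
      pulls sel σa (fun k l => Y k l ω) (fun t k i => W t k i ω) t),
        (fun k i => W t k i ω : Fin K → ℕ → ℝ)) :=
    (Measurable.prodMk (by fun_prop) hp).prodMk (by fun_prop)
  have h1 := h.lintegral_past_weight (σa := σa) hsel_meas t (measurable_one.indicator hDm)
  have h2 := h.lintegral_past_weight (σa := σa) hsel_meas t hgm
  calc _ = _ := (lintegral_indicator_one (hmap hDm)).symm
    _ = _ := h1
    _ ≤ _ := by
        refine lintegral_mono fun ω => ?_
        have hm2 : Measurable fun ω' => (((fun k l => Y k l ω : Fin K → ℕ → ℝ),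
            pulls sel σa (fun k l => Y k l ω) (fun t k i => W t k i ω) t),
              (fun k i => W t k i ω' : Fin K → ℕ → ℝ)) :=
          measurable_const.prodMk (by fun_prop)
        refine (lintegral_indicator_one (hm2 hDm)).trans_le ?_
        refine (h.measure_chooseArm_le hσ hsel ht τ (fun k l => Y k l ω)
          (pulls sel σa (fun k l => Y k l ω) (fun t k i => W t k i ω) t) k).trans (le_of_eq ?_)
        have hm3 : MeasurableSet {ω' | chooseArm sel σa (fun k l => Y k l ω)
            (fun k i => W t k i ω') t
            (pulls sel σa (fun k l => Y k l ω) (fun t k i => W t k i ω) t) = 0} :=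
          hm2 (hch (measurableSet_singleton 0))
        rw [← lintegral_indicator_const hm3]
        refine lintegral_congr fun ω' => ?_
        simp only [hg, Set.indicator_apply, Set.mem_ofPred_eq]
    _ = _ := h2.symm

lemma measure_arm_eq_le [NeZero K] (h : IsGaussianModel P μ Y W) (hσ : 0 < σa)
    (hsel : IsArgmax sel) (hsel_meas : Measurable sel) {t : ℕ} (ht : K ≤ t) (τ c : ℝ)
    (k : Fin K) :
    P {ω | arm sel σa (fun k l => Y k l ω) (fun t k i => W t k i ω) t = k} ≤
      ENNReal.ofReal c +
      ∫⁻ ω, (if arm sel σa (fun k l => Y k l ω) (fun t k i => W t k i ω) t = k then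
        (if c < exceedProb σa τ (fun l => Y k l ω)
          (pulls sel σa (fun k l => Y k l ω) (fun t k i => W t k i ω) t k) then 1 else 0)
            else 0) ∂P +
      ∫⁻ ω, (if arm sel σa (fun k l => Y k l ω) (fun t k i => W t k i ω) t = 0 then
        ENNReal.ofReal ((exceedProb σa τ (fun l => Y 0 l ω)
          (pulls sel σa (fun k l => Y k l ω) (fun t k i => W t k i ω) t 0))⁻¹ - 1) else 0) ∂P := by
  have h1 := h.measure_exceedProb_le_and_lt_armIndex hσ hsel_meas t τ c k
  have h2 := h.measure_arm_eq_and_armIndex_le hσ hsel hsel_meas ht τ k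
  have hN : Measurable fun ω =>
      pulls sel σa (fun k l => Y k l ω) (fun t k i => W t k i ω) t k :=
    (measurable_pi_apply k).comp (h.measurable_pulls hsel_meas σa t)
  have hQ : ∀ s, Measurable fun ω => exceedProb σa τ (fun l => Y k l ω) s := fun s =>
    (measurable_exceedProb σa τ s).comp (measurable_pi_lambda _ (h.measurable_reward k))
  set C : Set Ω := {ω | arm sel σa (fun k l => Y k l ω) (fun t k i => W t k i ω) t = k ∧
    c < exceedProb σa τ (fun l => Y k l ω)
      (pulls sel σa (fun k l => Y k l ω) (fun t k i => W t k i ω) t k)} with hC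
  have hCm : MeasurableSet C :=
    (h.measurable_arm hsel_meas σa t (measurableSet_singleton k)).inter
      (measurableSet_lt measurable_const (measurable_apply_nat hQ hN))
  have h3 : ∫⁻ ω, (if arm sel σa (fun k l => Y k l ω) (fun t k i => W t k i ω) t = k then
        (if c < exceedProb σa τ (fun l => Y k l ω)
          (pulls sel σa (fun k l => Y k l ω) (fun t k i => W t k i ω) t k) then 1 else 0)
            else 0) ∂P = P C := by
    rw [← lintegral_indicator_one hCm]
    refine lintegral_congr fun ω => ?_
    rw [← ite_and]
    simp only [Set.indicator_apply, hC, Set.mem_ofPred_eq, Pi.one_apply]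
  rw [h3]
  refine (measure_mono ?_).trans ((measure_union_le _ _).trans (add_le_add
    ((measure_union_le _ _).trans (add_le_add h1 le_rfl)) h2))
  intro ω hω
  rcases le_or_gt (armIndex σa (fun l => Y k l ω)
    (pulls sel σa (fun k l => Y k l ω) (fun t k i => W t k i ω) t k)
      (fun i => W t k i ω)) τ with hle | hlt
  · exact Or.inr ⟨hω, hle⟩
  · rcases le_or_gt (exceedProb σa τ (fun l => Y k l ω)
      (pulls sel σa (fun k l => Y k l ω) (fun t k i => W t k i ω) t k)) c with hq | hq
    · exact Or.inl (Or.inl ⟨hq, hlt⟩)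
    · exact Or.inl (Or.inr ⟨hω, hq⟩)

lemma sum_measure_arm_initial_le (σa : ℝ) (sel : (Fin K → ℝ) → Fin K) (T : ℕ) (k : Fin K) :
    ∑ t ∈ (Finset.range T).filter (· < K),
      P {ω | arm sel σa (fun k l => Y k l ω) (fun t k i => W t k i ω) t = k} ≤ 1 := by
  have hz : ∀ t ∈ (Finset.range T).filter (· < K), t ≠ (k : ℕ) →
      P {ω | arm sel σa (fun k l => Y k l ω) (fun t k i => W t k i ω) t = k} = 0 := by
    intro t ht hne
    have htK := (Finset.mem_filter.1 ht).2
    refine measure_mono_null (t := ∅) (fun ω hω => hne ?_) measure_empty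
    rw [Set.mem_ofPred_eq, arm_of_lt sel σa _ _ htK] at hω
    rw [← hω]
  by_cases hk : (k : ℕ) ∈ (Finset.range T).filter (· < K)
  · rw [Finset.sum_eq_single_of_mem _ hk hz]
    exact prob_le_one
  · rw [Finset.sum_eq_zero fun t ht => hz t ht fun he => hk (he ▸ ht)]
    exact zero_le_one

/-- The `2` is one for the initial pull plus one for at most `T` rounds of probability `1 / T` each.
-/
lemma sum_measure_arm_le [NeZero K] (h : IsGaussianModel P μ Y W) (hσ : 0 < σa)
    (hsel : IsArgmax sel) (hsel_meas : Measurable sel) (T : ℕ) (τ : ℝ) (k : Fin K) :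
    ∑ t ∈ Finset.range T,
        P {ω | arm sel σa (fun k l => Y k l ω) (fun t k i => W t k i ω) t = k} ≤
      2 + ∑ s ∈ Finset.Icc 1 (T - 1),
        (P {ω | (T : ℝ)⁻¹ < exceedProb σa τ (fun l => Y k l ω) s} +
          ∫⁻ ω, ENNReal.ofReal ((exceedProb σa τ (fun l => Y 0 l ω) s)⁻¹ - 1) ∂P) := by
  have hQ : ∀ j s, Measurable fun ω => exceedProb σa τ (fun l => Y j l ω) s := fun j s =>
    (measurable_exceedProb σa τ s).comp (measurable_pi_lambda _ (h.measurable_reward j))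
  have hQs : ∀ s, MeasurableSet {ω | (T : ℝ)⁻¹ < exceedProb σa τ (fun l => Y k l ω) s} :=
    fun s => measurableSet_lt measurable_const (hQ k s)
  have hlate : (Finset.range T).filter (fun t => ¬ t < K) = Finset.Ico K T := by
    ext t
    simp only [Finset.mem_filter, Finset.mem_range, Finset.mem_Ico]
    omega
  have hconst : ∑ _t ∈ Finset.Ico K T, ENNReal.ofReal (T : ℝ)⁻¹ ≤ 1 := by
    rw [Finset.sum_const, nsmul_eq_mul, ← ENNReal.ofReal_natCast,
      ← ENNReal.ofReal_mul (Nat.cast_nonneg _), ← ENNReal.ofReal_one]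
    refine ENNReal.ofReal_le_ofReal ?_
    rw [← div_eq_mul_inv]
    refine div_le_one_of_le₀ ?_ (Nat.cast_nonneg _)
    rw [Nat.card_Ico]
    exact_mod_cast Nat.sub_le _ _
  have h1 := h.sum_lintegral_pulled_le (σa := σa) hsel_meas T k
    (f := fun s ω => if (T : ℝ)⁻¹ < exceedProb σa τ (fun l => Y k l ω) s then 1 else 0)
    fun s => Measurable.ite (hQs s) measurable_const measurable_const
  have h2 := h.sum_lintegral_pulled_le (σa := σa) hsel_meas T 0
    (f := fun s ω => ENNReal.ofReal ((exceedProb σa τ (fun l => Y 0 l ω) s)⁻¹ - 1))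
    fun s => ((hQ 0 s).inv.sub_const 1).ennreal_ofReal
  have h3 : ∀ s, ∫⁻ ω, (if (T : ℝ)⁻¹ < exceedProb σa τ (fun l => Y k l ω) s then 1 else 0) ∂P =
      P {ω | (T : ℝ)⁻¹ < exceedProb σa τ (fun l => Y k l ω) s} := by
    intro s
    rw [← lintegral_indicator_one (hQs s)]
    refine lintegral_congr fun ω => ?_
    simp only [Set.indicator_apply, Set.mem_ofPred_eq, Pi.one_apply]
  simp only [h3] at h1
  rw [← Finset.sum_filter_add_sum_filter_not _ (· < K), hlate]
  refine (add_le_add (sum_measure_arm_initial_le σa sel T k) (Finset.sum_le_sum fun t ht =>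
    h.measure_arm_eq_le hσ hsel hsel_meas (Finset.mem_Ico.1 ht).1 τ (T : ℝ)⁻¹ k)).trans ?_
  rw [Finset.sum_add_distrib, Finset.sum_add_distrib, Finset.sum_add_distrib]
  refine (add_le_add le_rfl (add_le_add (add_le_add hconst h1) h2)).trans (le_of_eq ?_)
  rw [← one_add_one_eq_two]
  ring

end IsGaussianModel

lemma one_sub_pos_of_lt {σa : ℝ} (hσ : 1.5 < σa) : 0 < 1 - 2.25 * (σa ^ 2)⁻¹ := by
  have hq : (2.25 : ℝ) < σa ^ 2 := by nlinarith
  rw [sub_pos, ← div_eq_mul_inv, div_lt_one (by linarith)]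
  exact hq

lemma C₁_nonneg {σa : ℝ} (hσ : 1.5 < σa) : 0 ≤ C₁ σa := by
  have : 0 < 2 * σa ^ 2 - 1 := by nlinarith
  unfold C₁
  positivity

lemma C₂_nonneg {σa : ℝ} (hσ : 1.5 < σa) : 0 ≤ C₂ σa := by
  have := Real.rpow_nonneg (one_sub_pos_of_lt hσ).le (-(1 / 2))
  unfold C₂
  positivity

/-- The `4` is `7 / 2` from the `1 / T` terms plus `1 / 2` from the geometric series; at most `⌊L⌋`
sample sizes lie below the threshold. -/
lemma sum_threshold_le {L D : ℝ} (hL : 0 ≤ L) (hD : 0 ≤ D) (T : ℕ) :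
    ∑ s ∈ Finset.Icc 1 (T - 1),
      (7 / 2 * (T : ℝ)⁻¹ + 1 / 4 * (1 / 2) ^ s + if (s : ℝ) + 2 < L then D else 0) ≤
      4 + L * D := by
  have h1 : ∑ _s ∈ Finset.Icc 1 (T - 1), 7 / 2 * (T : ℝ)⁻¹ ≤ 7 / 2 := by
    rw [Finset.sum_const, Nat.card_Icc, nsmul_eq_mul]
    have : ((T - 1 + 1 - 1 : ℕ) : ℝ) * (T : ℝ)⁻¹ ≤ 1 := by
      rw [← div_eq_mul_inv]
      refine div_le_one_of_le₀ ?_ (Nat.cast_nonneg _)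
      exact_mod_cast (by omega : T - 1 + 1 - 1 ≤ T)
    linarith
  have h2 : ∑ s ∈ Finset.Icc 1 (T - 1), (1 / 4 : ℝ) * (1 / 2) ^ s ≤ 1 / 2 := by
    rw [← Finset.mul_sum]
    have h3 : ∑ s ∈ Finset.Icc 1 (T - 1), (1 / 2 : ℝ) ^ s ≤
        ∑ s ∈ Finset.range (T + 1), (1 / 2 : ℝ) ^ s := by
      refine Finset.sum_le_sum_of_subset_of_nonneg (fun s hs => ?_) fun s _ _ => by positivity
      rw [Finset.mem_Icc] at hs
      rw [Finset.mem_range]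
      omega
    have := sum_geometric_two_le (T + 1)
    linarith
  have h3 : ∑ s ∈ Finset.Icc 1 (T - 1), (if (s : ℝ) + 2 < L then D else 0) ≤ L * D := by
    rw [← Finset.sum_filter, Finset.sum_const, nsmul_eq_mul]
    refine mul_le_mul_of_nonneg_right ?_ hD
    have h4 : (Finset.Icc 1 (T - 1)).filter (fun s : ℕ => (s : ℝ) + 2 < L) ⊆
        Finset.Icc 1 ⌊L⌋₊ := by
      intro s hs
      rw [Finset.mem_filter, Finset.mem_Icc] at hs
      rw [Finset.mem_Icc]
      exact ⟨hs.1.1, Nat.le_floor (by linarith [hs.2])⟩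
    have h5 := Finset.card_le_card h4
    rw [Nat.card_Icc, Nat.add_sub_cancel] at h5
    exact (Nat.cast_le.2 h5).trans (Nat.floor_le hL)
  rw [Finset.sum_add_distrib, Finset.sum_add_distrib]
  linarith

namespace IsGaussianModel

variable {K : ℕ} {Ω : Type*} [MeasurableSpace Ω] {P : Measure Ω} [IsProbabilityMeasure P]
  {μ : Fin K → ℝ} {Y : Fin K → ℕ → Ω → ℝ} {W : ℕ → Fin K → ℕ → Ω → ℝ}
  {sel : (Fin K → ℝ) → Fin K} {σa : ℝ}

lemma sum_measureReal_arm_le [NeZero K] (h : IsGaussianModel P μ Y W) (hσ : 1.5 < σa)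
    (hsel : IsArgmax sel) (hsel_meas : Measurable sel) {T : ℕ} (hT : 2 ≤ T) {k : Fin K}
    (hk : 0 < gap μ k) :
    ∑ t ∈ Finset.range T,
        P.real {ω | arm sel σa (fun k l => Y k l ω) (fun t k i => W t k i ω) t = k} ≤
      6 + C₂ σa * (gap μ k ^ 2)⁻¹ * Real.log T := by
  have hσ0 : 0 < σa := by linarith
  have hℓ : 0 ≤ Real.log T := Real.log_natCast_nonneg T
  set Δ := gap μ k with hΔ
  set D : ℝ := 2.1 + 2 * (1 - 2.25 * (σa ^ 2)⁻¹) ^ (-(1 / 2) : ℝ) with hD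
  set L : ℝ := 128 * σa ^ 2 * Real.log T / Δ ^ 2 with hL
  have hD0 : 0 ≤ D := by
    have := Real.rpow_nonneg (one_sub_pos_of_lt hσ).le (-(1 / 2))
    positivity
  have hL0 : 0 ≤ L := by positivity
  -- One level `τ` serves both arms: it is `Δ / 2` above the mean of arm `k` and `Δ / 2` below that
  -- of arm `0`.
  have hτ : μ k + Δ / 2 = μ 0 - Δ / 2 := by
    rw [hΔ, gap]
    ring
  -- Below the threshold the probability is bounded by `1`, and `1 + D` is the factor with `3.1` in
  -- `C₂`. Above it, `7 / 2 = 1 / 4 + 13 / 4` and `1 / 4 = 1 / 8 + 1 / 8`.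
  have hterm : ∀ s ∈ Finset.Icc 1 (T - 1),
      P {ω | (T : ℝ)⁻¹ < exceedProb σa (μ 0 - Δ / 2) (fun l => Y k l ω) s} +
        ∫⁻ ω, ENNReal.ofReal ((exceedProb σa (μ 0 - Δ / 2) (fun l => Y 0 l ω) s)⁻¹ - 1) ∂P ≤
      ENNReal.ofReal (7 / 2 * (T : ℝ)⁻¹ + 1 / 4 * (1 / 2) ^ s +
        if (s : ℝ) + 2 < L then 1 + D else 0) := by
    intro s hs
    have hs1 := (Finset.mem_Icc.1 hs).1
    split_ifs with hc
    · have h1 := lintegral_inv_exceedProb_sub_one_le (h.measurable_reward 0) (h.law_reward 0)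
        (h.iIndepFun_reward 0) hσ hk hs1
      refine (add_le_add prob_le_one h1).trans ?_
      rw [← ENNReal.ofReal_one, ← ENNReal.ofReal_add zero_le_one hD0]
      refine ENNReal.ofReal_le_ofReal ?_
      have : 0 ≤ 7 / 2 * (T : ℝ)⁻¹ + 1 / 4 * (1 / 2) ^ s := by positivity
      linarith
    · have hgood : 128 * σa ^ 2 * Real.log T ≤ Δ ^ 2 * ((s : ℝ) + 2) := by
        rw [not_lt, hL, div_le_iff₀ (by positivity)] at hc
        linarith
      have h1 := lintegral_inv_exceedProb_sub_one_le_of_gap (h.measurable_reward 0)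
        (h.law_reward 0) (h.iIndepFun_reward 0) hσ hk hs1 hT hgood
      have h2 := measureReal_inv_lt_exceedProb_le (h.measurable_reward k) (h.law_reward k)
        (h.iIndepFun_reward k) hσ hk hs1 hT hgood
      rw [hτ] at h2
      rw [← ofReal_measureReal]
      refine (add_le_add (ENNReal.ofReal_le_ofReal h2) h1).trans (le_of_eq ?_)
      rw [← ENNReal.ofReal_add (by positivity) (by positivity)]
      congr 1
      ring
  have hmain := h.sum_measure_arm_le hσ0 hsel hsel_meas T (μ 0 - Δ / 2) k
  have hnn : ∀ s ∈ Finset.Icc 1 (T - 1), 0 ≤ 7 / 2 * (T : ℝ)⁻¹ + 1 / 4 * (1 / 2) ^ s +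
      if (s : ℝ) + 2 < L then 1 + D else 0 := by
    intro s _
    split_ifs <;> positivity
  have hfin : ENNReal.ofReal (∑ t ∈ Finset.range T,
      P.real {ω | arm sel σa (fun k l => Y k l ω) (fun t k i => W t k i ω) t = k}) ≤
      ENNReal.ofReal (6 + L * (1 + D)) := by
    rw [ENNReal.ofReal_sum_of_nonneg fun _ _ => measureReal_nonneg]
    simp only [measureReal_def, ENNReal.ofReal_toReal (measure_ne_top P _)]
    refine hmain.trans ((add_le_add le_rfl (Finset.sum_le_sum hterm)).trans ?_)
    rw [← ENNReal.ofReal_sum_of_nonneg hnn, ← ENNReal.ofReal_ofNat,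
      ← ENNReal.ofReal_add (by norm_num) (Finset.sum_nonneg hnn)]
    refine ENNReal.ofReal_le_ofReal ?_
    have := sum_threshold_le hL0 (by positivity : 0 ≤ 1 + D) T
    linarith
  rw [ENNReal.ofReal_le_ofReal_iff (by positivity)] at hfin
  refine hfin.trans (le_of_eq ?_)
  rw [hL, hD, C₂]
  ring

end IsGaussianModel

end ReBoot

theorem theorem1 {K : ℕ} [NeZero K] {Ω : Type*} [MeasurableSpace Ω]
    (P : Measure Ω) [IsProbabilityMeasure P]
    (μ : Fin K → ℝ) (hμ : ∀ k, μ k ≤ μ 0)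
    (Y : Fin K → ℕ → Ω → ℝ) (W : ℕ → Fin K → ℕ → Ω → ℝ)
    (hYW : ReBoot.IsGaussianModel P μ Y W)
    (sel : (Fin K → ℝ) → Fin K) (hsel : ReBoot.IsArgmax sel) (hsel_meas : Measurable sel)
    (σa : ℝ) (hσa : 1.5 < σa) (T : ℕ) :
    Integrable (fun ω =>
        ReBoot.totalReward sel σa (fun k l => Y k l ω) (fun t k i => W t k i ω) T) P ∧
      ReBoot.regret P μ sel σa Y W T ≤
        ∑ k ∈ Finset.univ.erase (0 : Fin K),
          ReBoot.gap μ k *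
            (6 + (ReBoot.C₁ σa + ReBoot.C₂ σa * (ReBoot.gap μ k ^ 2)⁻¹) * Real.log T) := by
  refine ⟨hYW.integrable_totalReward hsel_meas σa T, ?_⟩
  have h0 : ReBoot.gap μ 0 = 0 := sub_self _
  have hC1 := ReBoot.C₁_nonneg hσa
  have hC2 := ReBoot.C₂_nonneg hσa
  have hℓ : 0 ≤ Real.log T := Real.log_natCast_nonneg T
  rw [hYW.regret_eq_sum hsel_meas, ← Finset.add_sum_erase _ _ (Finset.mem_univ (0 : Fin K)), h0,
    zero_mul, zero_add]
  refine Finset.sum_le_sum fun k _ => ?_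
  have hgap : 0 ≤ ReBoot.gap μ k := sub_nonneg.2 (hμ k)
  rcases hgap.eq_or_lt with hk | hk
  · rw [← hk, zero_mul, zero_mul]
  refine mul_le_mul_of_nonneg_left ?_ hgap
  rw [add_mul, ← add_assoc]
  have h1 : 0 ≤ ReBoot.C₁ σa * Real.log T := by positivity
  rcases le_or_gt 2 T with hT | hT
  · have := hYW.sum_measureReal_arm_le hσa hsel hsel_meas hT hk
    linarith
  -- For `T < 2` the trivial bound of `T` pulls is already below `6`.
  · have h2 : 0 ≤ ReBoot.C₂ σa * (ReBoot.gap μ k ^ 2)⁻¹ * Real.log T := by positivity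
    have h3 : ∑ t ∈ Finset.range T, P.real {ω | ReBoot.arm sel σa (fun k l => Y k l ω)
        (fun t k i => W t k i ω) t = k} ≤ T := by
      refine (Finset.sum_le_card_nsmul _ _ 1 fun _ _ => measureReal_le_one).trans ?_
      simp
    have h4 : (T : ℝ) < 2 := by exact_mod_cast hT
    linarith
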